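/- Let $\Omega$ be a finite nonempty state space with uniform prior $\mu_0\in\Delta(\Omega)$. A Blackwell experiment is identified with its distribution of posteriors $\gamma\in\Delta(\Delta(\Omega))$, which satisfies $\int\mu\,d\gamma(\mu)=\mu_0$; let $\mathcal X$ be the set of all experiments. A buyer has a private type $t\in\mathcal T=[\underline t,\overline t]$, $\underline t<\overline t$, distributed with a continuous density $f>0$ on $\mathcal T$. The indirect utility of type $t$ at posterior $\mu$ is $u(\mu,t)$, where $u(\cdot,t)$ is convex and continuous on $\Delta(\Omega)$, the gain $u(\mu,t)-u(\mu_0,t)$ is strictly increasing in $t$ for every $\mu\neq\mu_0$, and this gain is differentiable in $t$ with a derivative that is continuous on $\Delta(\Omega)\times\mathcal T$. The value of an experiment is $$v(\gamma,t)=\int u(\mu,t)\,d\gamma(\mu)-u(\mu_0,t).$$ The environment is symmetric: $u(\cdot,t)$ is invariant under permutations of the states. A mechanism is a measurable map $(x,p):\mathcal T\to\mathcal X\times\mathbb R$ such that, for all $t,\hat t\in\mathcal T$, $v(x(t),t)-p(t)\ge v(x(\hat t),t)-p(\hat t)$ and $v(x(t),t)-p(t)\ge 0$. Given a continuous nonincreasing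 $\lambda:\mathcal T\to[0,\infty)$ with $\mathbb E[\lambda(t)]\le 1$, a mechanism is optimal if it maximizes $$\mathbb E\big[\lambda(t)\big(v(x(t),t)-p(t)\big)\big]+\mathbb E[p(t)]$$ among all mechanisms. A menu $\mathcal Y\subseteq\mathcal X$ is optimal if there is an optimal mechanism $(x,p)$ such that, for all $t$, $x(t)\in\mathcal Y$ or $x(t)$ is the outside option, i.e. the uninformative experiment $\delta_{\mu_0}$. For $\alpha\in[0,1]$ the truth-or-noise experiment $\gamma_\alpha$ puts mass $\mu_0(\omega)=1/|\Omega|$ on the posterior $(1-\alpha)\mu_0+\alpha\delta_\omega$ for each $\omega\in\Omega$; $\gamma_1$ is full information. Say that $u(\cdot,t)$ is increasingly concave in $t$ if for all $s<t$ in $\mathcal T$ there is a nondecreasing concave function $g$ on the range of $u(\cdot,s)$ with $u(\cdot,t)=g\circ u(\cdot,s)$, and strictly increasingly convex in $t$ if for all $s<t$ in $\mathcal T$ there is a nondecreasing strictly convex such $g$. Then for every such $f$ and $\lambda$: (i) if $u(\cdot,t)$ is increasingly concave in $t$, the menu $\{\gamma_1\}$ (selling full information) is optimal; (ii) if $u(\cdot,t)$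 is strictly increasingly convex in $t$, the menu $\{\gamma_\alpha\}_{\alpha\in[0,1]}$ of truth-or-noise experiments is optimal. -/

import Mathlib

open MeasureTheory Set
open scoped ENNReal

namespace SellingInformation

/-- The uniform prior over the finite state space `Ω`. -/
noncomputable abbrev prior (Ω : Type*) [Fintype Ω] [Nonempty Ω] : stdSimplex ℝ Ω :=
  stdSimplex.barycenter

/-- Blackwell experiments, identified with the distributions of posterior beliefs that are
Bayes plausible: the mean posterior is the prior. They carry the `σ`-algebra that they inherit
from the Giry `σ`-algebra on probability measures. -/
def Experiment (Ω : Type*) [Fintype Ω] [Nonempty Ω] : Type _ :=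
  {γ : ProbabilityMeasure (stdSimplex ℝ Ω) //
    ∀ ω, ∫ μ, μ.1 ω ∂(γ : Measure (stdSimplex ℝ Ω)) = (prior Ω).1 ω}

instance (Ω : Type*) [Fintype Ω] [Nonempty Ω] : MeasurableSpace (Experiment Ω) :=
  inferInstanceAs (MeasurableSpace (Subtype _))

/-- The posterior distribution of an experiment, as a measure on the simplex of beliefs. -/
noncomputable def Experiment.law {Ω : Type*} [Fintype Ω] [Nonempty Ω] (γ : Experiment Ω) :
    Measure (stdSimplex ℝ Ω) :=
  (γ.1 : Measure (stdSimplex ℝ Ω))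

/-- The uninformative experiment: the posterior is always the prior. It gives every type
payoff `0` and is the outside option. -/
noncomputable def noInformation (Ω : Type*) [Fintype Ω] [Nonempty Ω] : Experiment Ω :=
  ⟨⟨Measure.dirac (prior Ω), inferInstance⟩, fun ω => by
    simp [ProbabilityMeasure.coe_mk]⟩

/-- The belief `(1 - α) μ₀ + α δ_ω`. -/
noncomputable def truthOrNoiseBelief {Ω : Type*} [Fintype Ω] [DecidableEq Ω] [Nonempty Ω]
    (α : unitInterval) (ω : Ω) : stdSimplex ℝ Ω :=
  ⟨(1 - (α : ℝ)) • (prior Ω).1 + (α : ℝ) • Pi.single ω (1 : ℝ),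
    convex_stdSimplex ℝ Ω (prior Ω).2 (single_mem_stdSimplex ℝ ω)
      (sub_nonneg.2 α.2.2) α.2.1 (by ring)⟩

/-- The posterior distribution with mass `μ₀(ω) = 1 / |Ω|` at `(1 - α) μ₀ + α δ_ω`, for
each state `ω`. -/
noncomputable def truthOrNoiseLaw (Ω : Type*) [Fintype Ω] [DecidableEq Ω] [Nonempty Ω]
    (α : unitInterval) : Measure (stdSimplex ℝ Ω) :=
  ∑ ω : Ω, (Fintype.card Ω : ℝ≥0∞)⁻¹ • Measure.dirac (truthOrNoiseBelief α ω)

instance (Ω : Type*) [Fintype Ω] [DecidableEq Ω] [Nonempty Ω] (α : unitInterval) :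
    IsProbabilityMeasure (truthOrNoiseLaw Ω α) := by
  constructor
  simp only [truthOrNoiseLaw, Measure.coe_finsetSum, Finset.sum_apply, Measure.smul_apply,
    measure_univ, smul_eq_mul, mul_one, Finset.sum_const, Finset.card_univ, nsmul_eq_mul]
  exact ENNReal.mul_inv_cancel (by simp) (by simp)

/-- The truth-or-noise experiment `γ_α`. -/
noncomputable def truthOrNoise (Ω : Type*) [Fintype Ω] [DecidableEq Ω] [Nonempty Ω]
    (α : unitInterval) : Experiment Ω :=
  ⟨⟨truthOrNoiseLaw Ω α, inferInstance⟩, fun ω => by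
    have hc : (Fintype.card Ω : ℝ) ≠ 0 := by simp
    have h1 : ∀ ω' ∈ (Finset.univ : Finset Ω), Integrable (fun μ : stdSimplex ℝ Ω => μ.1 ω)
        ((Fintype.card Ω : ℝ≥0∞)⁻¹ • Measure.dirac (truthOrNoiseBelief α ω')) := fun ω' _ =>
      (integrable_dirac (by simp)).smul_measure (by simp)
    simp only [ProbabilityMeasure.coe_mk, truthOrNoiseLaw]
    rw [integral_finsetSum_measure h1]
    simp only [integral_smul_measure, integral_dirac, truthOrNoiseBelief, Pi.add_apply,
      Pi.smul_apply, smul_eq_mul, Pi.single_apply, stdSimplex.barycenter_apply,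
      ← Finset.mul_sum, Finset.sum_add_distrib, Finset.sum_const, Finset.card_univ,
      nsmul_eq_mul, Finset.sum_ite_eq, Finset.mem_univ, if_true, ENNReal.toReal_inv,
      ENNReal.toReal_natCast]
    field_simp
    ring⟩

/-- The fully informative experiment: the posterior is `δ_ω` with probability `1 / |Ω|`. -/
noncomputable def fullInformation (Ω : Type*) [Fintype Ω] [DecidableEq Ω] [Nonempty Ω] :
    Experiment Ω :=
  truthOrNoise Ω 1

theorem fullInformation_law (Ω : Type*) [Fintype Ω] [DecidableEq Ω] [Nonempty Ω] :
    (fullInformation Ω).law =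
      ∑ ω : Ω, (Fintype.card Ω : ℝ≥0∞)⁻¹ • Measure.dirac (stdSimplex.vertex (S := ℝ) ω) := by
  have h : ∀ ω : Ω, truthOrNoiseBelief 1 ω = stdSimplex.vertex (S := ℝ) ω := fun ω =>
    Subtype.ext (by simp [truthOrNoiseBelief])
  change truthOrNoiseLaw Ω 1 = _
  simp only [truthOrNoiseLaw, h]

/-- `u μ t` is the indirect utility of type `t ∈ [a, b]` at the belief `μ`: convex and continuous
in the belief; the gain over the prior is strictly increasing in the type at every
belief other than the prior, and differentiable in the type with a jointly continuous
derivative. -/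
structure IsIndirectUtility {Ω : Type*} [Fintype Ω] [Nonempty Ω] (a b : ℝ)
    (u : (Ω → ℝ) → ℝ → ℝ) : Prop where
  convexOn : ∀ t ∈ Icc a b, ConvexOn ℝ (stdSimplex ℝ Ω) (fun μ => u μ t)
  continuousOn : ∀ t ∈ Icc a b, ContinuousOn (fun μ => u μ t) (stdSimplex ℝ Ω)
  strictMonoOn : ∀ μ ∈ stdSimplex ℝ Ω, μ ≠ (prior Ω).1 →
    StrictMonoOn (fun t => u μ t - u (prior Ω).1 t) (Icc a b)
  exists_deriv : ∃ d : (Ω → ℝ) → ℝ → ℝ,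
    (∀ μ ∈ stdSimplex ℝ Ω, ∀ t ∈ Icc a b,
      HasDerivWithinAt (fun s => u μ s - u (prior Ω).1 s) (d μ t) (Icc a b) t) ∧
    ContinuousOn (fun z : (Ω → ℝ) × ℝ => d z.1 z.2) (stdSimplex ℝ Ω ×ˢ Icc a b)

/-- The environment is symmetric: utilities are invariant under permutations of the states. -/
def IsSymmetricEnv {Ω : Type*} [Fintype Ω] (a b : ℝ) (u : (Ω → ℝ) → ℝ → ℝ) : Prop :=
  ∀ σ : Equiv.Perm Ω, ∀ μ ∈ stdSimplex ℝ Ω, ∀ t ∈ Icc a b, u (μ ∘ σ) t = u μ t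

/-- Every higher type's utility is a nondecreasing concave transformation of every lower
type's utility. The transformation matters only on the range of the latter. -/
def IncreasinglyConcave {Ω : Type*} [Fintype Ω] (a b : ℝ) (u : (Ω → ℝ) → ℝ → ℝ) : Prop :=
  ∀ s ∈ Icc a b, ∀ t ∈ Icc a b, s < t → ∃ g : ℝ → ℝ,
    ConcaveOn ℝ ((fun μ => u μ s) '' stdSimplex ℝ Ω) g ∧
    MonotoneOn g ((fun μ => u μ s) '' stdSimplex ℝ Ω) ∧
    ∀ μ ∈ stdSimplex ℝ Ω, u μ t = g (u μ s)

/-- Every higher type's utility is a nondecreasing strictly convex transformation of every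
lower type's utility. -/
def StrictlyIncreasinglyConvex {Ω : Type*} [Fintype Ω] (a b : ℝ) (u : (Ω → ℝ) → ℝ → ℝ) :
    Prop :=
  ∀ s ∈ Icc a b, ∀ t ∈ Icc a b, s < t → ∃ g : ℝ → ℝ,
    StrictConvexOn ℝ ((fun μ => u μ s) '' stdSimplex ℝ Ω) g ∧
    MonotoneOn g ((fun μ => u μ s) '' stdSimplex ℝ Ω) ∧
    ∀ μ ∈ stdSimplex ℝ Ω, u μ t = g (u μ s)

/-- `f` is a continuous positive probability density on the type space `[a, b]`. -/
structure IsTypeDensity (a b : ℝ) (f : Icc a b → ℝ) : Prop where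
  continuous : Continuous f
  pos : ∀ t, 0 < f t
  integral_eq_one : ∫ t, f t ∂(volume.comap Subtype.val) = 1

/-- The expectation of a function of the type when the type has density `f`. -/
noncomputable def expect {a b : ℝ} (f φ : Icc a b → ℝ) : ℝ :=
  ∫ t, φ t * f t ∂(volume.comap Subtype.val)

/-- Redistributive welfare weights: continuous, nonnegative, nonincreasing in the type, with
expectation at most `1`. -/
structure IsRedistributiveWeight {a b : ℝ} (f w : Icc a b → ℝ) : Prop where
  continuous : Continuous w
  nonneg : ∀ t, 0 ≤ w t
  antitone : Antitone w
  expect_le_one : expect f w ≤ 1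

/-- The valuation `v(γ, t)` of type `t` for the experiment `γ`. -/
noncomputable def value {Ω : Type*} [Fintype Ω] [Nonempty Ω] (u : (Ω → ℝ) → ℝ → ℝ)
    (γ : Experiment Ω) (t : ℝ) : ℝ :=
  (∫ μ : stdSimplex ℝ Ω, u μ.1 t ∂γ.law) - u (prior Ω).1 t

/-- A direct-revelation mechanism: a measurable assignment of an experiment and a payment to
every reported type in `[a, b]`. -/
structure Mechanism (Ω : Type*) [Fintype Ω] [Nonempty Ω] (a b : ℝ) where
  alloc : Icc a b → Experiment Ω
  pay : Icc a b → ℝ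
  measurable_alloc : Measurable alloc
  measurable_pay : Measurable pay

/-- Incentive compatibility and individual rationality. -/
structure Mechanism.IsFeasible {Ω : Type*} [Fintype Ω] [Nonempty Ω] {a b : ℝ}
    (u : (Ω → ℝ) → ℝ → ℝ) (M : Mechanism Ω a b) : Prop where
  ic : ∀ t t' : Icc a b,
    value u (M.alloc t') t - M.pay t' ≤ value u (M.alloc t) t - M.pay t
  ir : ∀ t : Icc a b, 0 ≤ value u (M.alloc t) t - M.pay t

/-- The seller's objective: weighted welfare of the buyer plus revenue. -/
noncomputable def Mechanism.objective {Ω : Type*} [Fintype Ω] [Nonempty Ω] {a b : ℝ}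
    (u : (Ω → ℝ) → ℝ → ℝ) (f w : Icc a b → ℝ) (M : Mechanism Ω a b) : ℝ :=
  expect f (fun t => w t * (value u (M.alloc t) t - M.pay t)) + expect f M.pay

/-- The mechanism is feasible and attains the highest objective among all feasible
mechanisms, which may use arbitrary experiments. -/
def Mechanism.IsOptimal {Ω : Type*} [Fintype Ω] [Nonempty Ω] {a b : ℝ}
    (u : (Ω → ℝ) → ℝ → ℝ) (f w : Icc a b → ℝ) (M : Mechanism Ω a b) : Prop :=
  M.IsFeasible u ∧
    ∀ M' : Mechanism Ω a b, M'.IsFeasible u → M'.objective u f w ≤ M.objective u f w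

/-- A menu is optimal if some optimal mechanism assigns to every type an item of the menu or
the outside option. -/
def IsOptimalMenu {Ω : Type*} [Fintype Ω] [Nonempty Ω] {a b : ℝ}
    (u : (Ω → ℝ) → ℝ → ℝ) (f w : Icc a b → ℝ) (Y : Set (Experiment Ω)) : Prop :=
  ∃ M : Mechanism Ω a b, M.IsOptimal u f w ∧ ∀ t, M.alloc t ∈ insert (noInformation Ω) Y

end SellingInformation

/-! With `S` the buyer's gross value and `U` the buyer's net utility, the objective is the integral
of `S + (w - 1) U`. Only the constraints by which higher types do not imitate lower ones are used
for the upper bound, together with `U` continuous, nondecreasing and nonnegative at the bottom.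

These constraints survive a replacement that keeps `S` and `U` and makes each item less attractive
to higher types. In the concave case `v(γ, t) / v(γ₁, t)` rises with `t`, so `γ` is replaced by full
information with probability `q` equal to that ratio. In the convex case `γ` is replaced by the
truth-or-noise experiment of equal value to `t`, and Jensen's inequality does the rest. Both leave a
one-dimensional screening problem `h α t`, convex in `α` with log-supermodular increments
(`IsScreening`).

There, cut `[0, 1]` into a grid and treat each increment of `h` as a separate good. Running minima
of `U` minus the value of the first `i` goods split the rent good by good, up to a lump transfer and
an error of one top increment (`exists_thresholds`). A nondecreasing transfer cannot help, since `w`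
is nonincreasing with mean at most `1` (`integral_sub_one_mul_nonpos`). For each good a posted price
is at least as good (`layer_le`), and log-supermodularity orders the thresholds (`badSet_subset`),
so the goods assemble into a monotone allocation satisfying all constraints
(`exists_implementable_of_thresholds`). Compactness gives a maximizer and refining the grid removes
the error. If `h` is linear in `α`, all goods are proportional and one threshold suits them all. -/

namespace SellingInformation

/-! ### Splitting the rent into goods by running minima. -/

section LeastArgmin

variable {T : Type*} [LinearOrder T]

/-- `c t` is the least minimizer of `F` on `[t, ∞)`. -/
structure IsLeastArgmin (F : T → ℝ) (c : T → T) : Prop where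
  le : ∀ t, t ≤ c t
  min : ∀ t t', t ≤ t' → F (c t) ≤ F t'
  lt : ∀ t t', t ≤ t' → t' < c t → F (c t) < F t'

theorem exists_isLeastArgmin [TopologicalSpace T] [OrderTopology T] [CompactSpace T]
    {F : T → ℝ} (hF : Continuous F) : ∃ c, IsLeastArgmin F c := by
  have key : ∀ t, ∃ x, IsLeast (Ici t ∩ ⋂ t' ∈ Ici t, {x | F x ≤ F t'}) x := by
    intro t
    apply IsCompact.exists_isLeast
    · apply IsClosed.isCompact
      exact isClosed_Ici.inter
        (isClosed_biInter fun t' _ => isClosed_le hF continuous_const)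
    · obtain ⟨x, hx, hm⟩ := (isClosed_Ici.isCompact : IsCompact (Ici t)).exists_isMinOn
        nonempty_Ici hF.continuousOn
      exact ⟨x, hx, mem_iInter₂.2 fun t' ht => hm ht⟩
  choose c hc using key
  have hmin : ∀ t t', t ≤ t' → F (c t) ≤ F t' := fun t t' h =>
    mem_iInter₂.1 (hc t).1.2 t' h
  refine ⟨c, fun t => (hc t).1.1, hmin, fun t t' h hlt => ?_⟩
  by_contra hcon
  push Not at hcon
  exact absurd ((hc t).2 ⟨h, mem_iInter₂.2 fun s hs => hcon.trans (hmin t s hs)⟩)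
    (not_le.2 hlt)

namespace IsLeastArgmin

variable {F G : T → ℝ} {c d : T → T}

theorem monotone (hc : IsLeastArgmin F c) : Monotone c := by
  intro t t' h
  by_cases h1 : t' ≤ c t
  · by_contra h2
    push Not at h2
    exact absurd (hc.lt t (c t') (h.trans (hc.le t')) h2) (not_lt.2 (hc.min t' (c t) h1))
  · exact (le_of_not_ge h1).trans (hc.le t')

theorem idem (hc : IsLeastArgmin F c) (t : T) : c (c t) = c t := by
  by_contra h
  have h1 : c t < c (c t) := lt_of_le_of_ne (hc.le _) (Ne.symm h)
  exact absurd (hc.lt (c t) (c t) le_rfl h1)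
    (not_lt.2 (hc.min t _ ((hc.le t).trans (hc.le _))))

theorem eq_self (hc : IsLeastArgmin F c) {t : T} (h : ∀ t', t ≤ t' → F t ≤ F t') :
    c t = t := by
  by_contra hne
  have h1 : t < c t := lt_of_le_of_ne (hc.le _) (Ne.symm hne)
  exact absurd (hc.lt t t le_rfl h1) (not_lt.2 (h _ h1.le))

/-- Monotone comparative statics: if `d t < c t`, leastness gives `F (c t) < F (d t)` while `G (d t)
≤ G (c t)`, so `F - G` would fall from `d t` to `c t`. -/
theorem le_of_sub_monotone (hc : IsLeastArgmin F c) (hd : IsLeastArgmin G d)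
    (h : Monotone fun t => F t - G t) (t : T) : c t ≤ d t := by
  by_contra hlt
  push Not at hlt
  have h1 := hc.lt t (d t) (hd.le t) hlt
  have h2 := hd.min t (c t) (hc.le t)
  have h3 := h hlt.le
  simp only at h3
  linarith

end IsLeastArgmin

/-- The types in the gaps of `c` at which closing the gap is not worthwhile. -/
def badSet (w ρ : T → ℝ) (c : T → T) : Set T :=
  {t | ρ (c t) < w t * (ρ (c t) - ρ t)}

-- Fixed points of `c` are the types served, and the other types lie in gaps. Above `y` no type is
-- bad, so filling the gaps loses nothing. Below `y`, either `c t = y` already, or a bad type lies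
-- above `t`. Then `w t > 1`, and both dropping service and raising the rent to `ρ y` are
-- improvements.
open Classical in
theorem layer_le [BoundedOrder T] {w ρ : T → ℝ} {c : T → T} (hw : Antitone w)
    (hρ : Monotone ρ) (hρ0 : ∀ t, 0 ≤ ρ t)
    (hle : ∀ t, t ≤ c t) (hmono : Monotone c) (hidem : ∀ t, c (c t) = c t) {y : T}
    (hy : IsLUB (insert (c ⊥) (c '' badSet w ρ c)) y) {t : T} (hty : t ≠ y) :
    (if c t = t then ρ t else 0) + (w t - 1) * ρ (c t) ≤
      (if y ≤ t then ρ t else 0) + (w t - 1) * ρ (max t y) := by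
  rcases lt_or_gt_of_ne hty with h | h
  · rw [if_neg (not_le.2 h), max_eq_right h.le, zero_add]
    obtain ⟨x, hx, htx⟩ := (lt_isLUB_iff hy).1 h
    by_cases hct : c t = y
    · rw [if_neg (by rw [hct]; exact h.ne'), hct, zero_add]
    have hxy : x ≤ y := hy.1 hx
    have hcx : c x = x := by
      rcases hx with rfl | ⟨s, _, rfl⟩ <;> exact hidem _
    have hctx : c t ≤ x := hcx ▸ hmono htx.le
    have hlty : c t < y := lt_of_le_of_ne (hctx.trans hxy) hct
    obtain ⟨x', hx', hcx'⟩ := (lt_isLUB_iff hy).1 hlty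
    have hx'y : x' ≤ y := hy.1 hx'
    rcases hx' with rfl | ⟨s, hs, rfl⟩
    · exact absurd (hmono (bot_le : ⊥ ≤ t)) (not_le.2 hcx')
    · have hts : t ≤ s := by
        by_contra hst
        push Not at hst
        exact absurd (hmono hst.le) (not_le.2 hcx')
      have hs' : ρ (c s) < w s * (ρ (c s) - ρ s) := hs
      have hwts := hw hts
      have h1 : 0 ≤ ρ (c s) - ρ s := sub_nonneg.2 (hρ (hle s))
      have h2 : 1 < w s := by
        by_contra h2
        push Not at h2
        nlinarith [hρ0 s]
      by_cases hfix : c t = t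
      · rw [if_pos hfix, hfix]
        have h3 : ρ (c s) ≤ ρ y := hρ hx'y
        have h4 : ρ t ≤ ρ s := hρ hts
        nlinarith
      · rw [if_neg hfix, zero_add]
        exact mul_le_mul_of_nonneg_left (hρ hlty.le) (by linarith)
  · rw [if_pos h.le, max_eq_left h.le]
    by_cases hfix : c t = t
    · rw [if_pos hfix, hfix]
    · rw [if_neg hfix]
      have hnb : t ∉ badSet w ρ c := fun hb =>
        absurd ((hle t).trans (hy.1 (mem_insert_of_mem _ ⟨t, hb, rfl⟩))) (not_le.2 h)
      have hnb' : w t * (ρ (c t) - ρ t) ≤ ρ (c t) := not_lt.1 hnb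
      linarith

/-- The increments, between consecutive levels of the allocation, of a value function that is
convex in the allocation and has log-supermodular increments in the allocation and the type. -/
structure IsLayered (n : ℕ) (ρ : ℕ → T → ℝ) : Prop where
  nonneg : ∀ i ≤ n, ∀ t, 0 ≤ ρ i t
  monotone : ∀ i ≤ n, Monotone (ρ i)
  le_succ : ∀ i < n, ∀ t, ρ i t ≤ ρ (i + 1) t
  cross : ∀ i < n, ∀ t t', t ≤ t' → ρ i t' * ρ (i + 1) t ≤ ρ i t * ρ (i + 1) t'

namespace IsLayered

variable {n : ℕ} {ρ : ℕ → T → ℝ}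

/-- Where `ρ i` is positive, the ratio `ρ (i + 1) / ρ i` is at least `1` and nondecreasing in the
type, so the difference `ρ i * (ratio - 1)` is nondecreasing too. Zeros of `ρ i` are treated apart.
-/
theorem sub_le_sub (h : IsLayered n ρ) {i : ℕ} (hi : i < n) {t t' : T} (ht : t ≤ t') :
    ρ i t' - ρ i t ≤ ρ (i + 1) t' - ρ (i + 1) t := by
  have h1 := h.cross i hi t t' ht
  have h2 := h.le_succ i hi t
  have h3 := h.le_succ i hi t'
  have h4 := h.monotone i hi.le ht
  have h5 := h.monotone (i + 1) hi ht
  have h6 := h.nonneg i hi.le t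
  rcases h6.eq_or_lt with h0 | h0
  · rcases (h.nonneg (i + 1) hi t).eq_or_lt with h7 | h7
    · linarith
    · rw [← h0] at h1
      have : ρ i t' ≤ 0 := by
        by_contra hc
        push Not at hc
        nlinarith
      linarith
  · by_contra hc
    push Not at hc
    nlinarith

/-- A type is bad when `w t * ρ t < (w t - 1) * ρ (c t)`. Log-supermodularity preserves this
comparison in the next layer, and a larger `d t` only raises the right side because `w t > 1`. This
is what nests the thresholds. -/
theorem badSet_subset (h : IsLayered n ρ) {i : ℕ} (hi : i < n) {w : T → ℝ}
    {c d : T → T} (hc : ∀ t, t ≤ c t) (hcd : ∀ t, c t ≤ d t) :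
    badSet w (ρ i) c ⊆ badSet w (ρ (i + 1)) d := by
  intro t ht
  have ht : ρ i (c t) < w t * (ρ i (c t) - ρ i t) := ht
  change ρ (i + 1) (d t) < w t * (ρ (i + 1) (d t) - ρ (i + 1) t)
  have h0 := h.nonneg i hi.le t
  have h1 := h.cross i hi t (c t) (hc t)
  have h2 := h.le_succ i hi (c t)
  have h3 := h.monotone (i + 1) hi (hcd t)
  have h4 := h.monotone i hi.le (hc t)
  have h5 : 1 < w t := by
    by_contra h5
    push Not at h5
    nlinarith
  have h6 : 0 < ρ i (c t) := by
    by_contra h6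
    push Not at h6
    have : ρ i (c t) = 0 := le_antisymm h6 (h.nonneg i hi.le _)
    nlinarith
  have h7 : w t * ρ (i + 1) t < (w t - 1) * ρ (i + 1) (c t) := by
    have h8 : w t * ρ i t < (w t - 1) * ρ i (c t) := by linarith
    have h9 : w t * ρ i t * ρ (i + 1) (c t) < (w t - 1) * ρ i (c t) * ρ (i + 1) (c t) :=
      mul_lt_mul_of_pos_right h8 (h6.trans_le h2)
    have h10 : w t * (ρ i (c t) * ρ (i + 1) t) ≤ w t * (ρ i t * ρ (i + 1) (c t)) :=
      mul_le_mul_of_nonneg_left h1 (by linarith)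
    by_contra hcon
    push Not at hcon
    have := mul_le_mul_of_nonneg_left hcon h6.le
    linarith
  have h8 : (w t - 1) * ρ (i + 1) (c t) ≤ (w t - 1) * ρ (i + 1) (d t) :=
    mul_le_mul_of_nonneg_left h3 (by linarith)
  linarith

/-- Each accumulated difference is dominated by the same difference in the next layer, so the sum
telescopes into a single increment of layer `m`. This keeps the error of the rent decomposition from
growing with the number of layers. -/
theorem sum_sub_le (h : IsLayered n ρ) {c : ℕ → T} (hc : Monotone c) {m : ℕ} (hm : m ≤ n) :
    ∑ i ∈ Finset.range (m + 1), (ρ i (c (i + 1)) - ρ i (c i)) ≤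
      ρ m (c (m + 1)) - ρ m (c 0) := by
  induction m with
  | zero => simp
  | succ k ih =>
    rw [Finset.sum_range_succ]
    have h1 := ih (by omega)
    have h2 := h.sub_le_sub (show k < n by omega) (hc (Nat.zero_le (k + 1)))
    linarith

end IsLayered

open Classical in
/-- Every allocation that deters imitation of lower types is dominated, pointwise up to a
monotone transfer and a small error, by an allocation that assigns the layers to the types
above nested thresholds. -/
theorem exists_thresholds [BoundedOrder T] [TopologicalSpace T] [OrderTopology T]
    [CompactSpace T] {n : ℕ} {ρ : ℕ → T → ℝ} (hρ : IsLayered n ρ)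
    (hρc : ∀ i ≤ n, Continuous (ρ i)) {w S U : T → ℝ} {ε : ℝ}
    (hw : Antitone w) (hw0 : ∀ t, 0 ≤ w t) (hU : Continuous U) (hUm : Monotone U)
    (hU0 : 0 ≤ U ⊥) (hε : ρ n ⊤ ≤ ε)
    (hS : ∀ t, ∃ j ≤ n + 1, S t ≤ ∑ k ∈ Finset.range j, ρ k t + ε ∧
      ∀ t', t ≤ t' → U t + ∑ k ∈ Finset.range j, ρ k t' - ∑ k ∈ Finset.range j, ρ k t ≤ U t') :
    ∃ y : ℕ → T, ∃ D : T → ℝ, (∀ i j, i ≤ j → j ≤ n → y i ≤ y j) ∧ Monotone D ∧ 0 ≤ D ⊥ ∧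
      ∀ t, (∀ i ≤ n, t ≠ y i) → S t + (w t - 1) * U t ≤
        ∑ i ∈ Finset.range (n + 1), ((if y i ≤ t then ρ i t else 0) +
          (w t - 1) * (ρ i (max t (y i)) - ρ i (y i))) + (w t - 1) * D t + 2 * ε := by
  set η : ℕ → T → ℝ := fun i t => ∑ k ∈ Finset.range i, ρ k t with hη
  have hηs : ∀ i t, η (i + 1) t = η i t + ρ i t := fun i t => Finset.sum_range_succ _ _
  have hηc : ∀ i ≤ n + 1, Continuous (η i) := fun i hi =>
    continuous_finsetSum _ fun k hk => hρc k (by have := Finset.mem_range.1 hk; omega)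
  have hηd : ∀ i j, i ≤ j → j ≤ n + 1 → ∀ t t', t ≤ t' →
      η i t' - η i t ≤ η j t' - η j t := by
    intro i j hij hj t t' ht
    induction j, hij using Nat.le_induction with
    | base => exact le_rfl
    | succ k hk ih =>
      have h1 := ih (by omega)
      have h2 := hρ.monotone k (by omega) ht
      rw [hηs, hηs]
      linarith
  -- Clamping the index makes `c` defined and monotone over all of `ℕ`, although `η i` is controlled
  -- only for `i ≤ n + 1`.
  have hex : ∀ i, ∃ c, IsLeastArgmin (fun t => U t - η (min i (n + 1)) t) c := fun i =>
    exists_isLeastArgmin (hU.sub (hηc _ (min_le_right _ _)))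
  choose c hc using hex
  have hc' : ∀ i ≤ n + 1, IsLeastArgmin (fun t => U t - η i t) (c i) := fun i hi => by
    have := hc i
    rwa [min_eq_left hi] at this
  have hcm : ∀ t, Monotone fun i => c i t := fun t => monotone_nat_of_le_succ fun i => by
    refine (hc i).le_of_sub_monotone (hc (i + 1)) (fun s s' hs => ?_) t
    have := hηd (min i (n + 1)) (min (i + 1) (n + 1)) (by omega) (by omega) s s' hs
    simp only
    linarith
  have hlub : ∀ i, ∃ y, IsLUB (insert (c (i + 1) ⊥)
      (c (i + 1) '' badSet w (ρ i) (c (i + 1)))) y := fun i => by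
    obtain ⟨y, hy⟩ := (isClosed_closure.isCompact (s := closure (insert (c (i + 1) ⊥)
      (c (i + 1) '' badSet w (ρ i) (c (i + 1)))))).exists_isGreatest
      (insert_nonempty _ _).closure
    exact ⟨y, by simpa only [IsLUB, upperBounds_closure] using hy.isLUB⟩
  choose y hy using hlub
  have hys : ∀ i < n, y i ≤ y (i + 1) := by
    intro i hi
    refine (isLUB_le_iff (hy i)).2 ?_
    rintro x (rfl | ⟨s, hs, rfl⟩)
    · exact (hcm ⊥ (Nat.le_succ (i + 1))).trans ((hy (i + 1)).1 (mem_insert _ _))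
    · refine (hcm s (Nat.le_succ (i + 1))).trans
        ((hy (i + 1)).1 (mem_insert_of_mem _ ⟨s, ?_, rfl⟩))
      exact hρ.badSet_subset hi (hc (i + 1)).le (fun t => hcm t (Nat.le_succ (i + 1))) hs
  -- `W i t` is the minimum of `U - η i` above `t`. Testing each minimizer in the neighbouring
  -- problem sandwiches `W i - W (i + 1)` between values of `ρ i`.
  set W : ℕ → T → ℝ := fun i t => U (c i t) - η i (c i t) with hW
  have hW1 : ∀ i ≤ n, ∀ t, ρ i (c i t) ≤ W i t - W (i + 1) t := fun i hi t => by
    have := (hc' (i + 1) (by omega)).min t (c i t) ((hc i).le t)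
    simp only [hηs] at this
    simp only [hW, hηs]
    linarith
  have hW2 : ∀ i ≤ n, ∀ t, W i t - W (i + 1) t ≤ ρ i (c (i + 1) t) := fun i hi t => by
    have := (hc' i (by omega)).min t (c (i + 1) t) ((hc (i + 1)).le t)
    simp only [hW, hηs]
    linarith
  have hW0 : ∀ t, W 0 t = U t := fun t => by
    have h1 := (hc' 0 (by omega)).min t t le_rfl
    have h2 := hUm ((hc 0).le t)
    simp only [hη, Finset.range_zero, Finset.sum_empty, sub_zero] at h1
    simp only [hW, hη, Finset.range_zero, Finset.sum_empty, sub_zero]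
    linarith
  have hsum : ∀ t, U t - W (n + 1) t = ∑ i ∈ Finset.range (n + 1), (W i t - W (i + 1) t) :=
    fun t => by rw [Finset.sum_range_sub', hW0]
  have hUle : ∀ t, U t ≤ W (n + 1) t + ∑ i ∈ Finset.range (n + 1), ρ i (c (i + 1) t) :=
    fun t => by
      have := Finset.sum_le_sum (s := Finset.range (n + 1)) fun i hi =>
        hW2 i (by have := Finset.mem_range.1 hi; omega) t
      linarith [hsum t]
  have hUge : ∀ t, W (n + 1) t + ∑ i ∈ Finset.range (n + 1), ρ i (c (i + 1) t) ≤ U t + ε :=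
    fun t => by
      have h1 := Finset.sum_le_sum (s := Finset.range (n + 1)) fun i hi =>
        hW1 i (by have := Finset.mem_range.1 hi; omega) t
      have h2 := hρ.sum_sub_le (hcm t) le_rfl
      have h3 := hρ.monotone n le_rfl (le_top : c (n + 1) t ≤ ⊤)
      have h4 := hρ.nonneg n le_rfl (c 0 t)
      rw [Finset.sum_sub_distrib] at h2
      linarith [hsum t]
  -- The transfer is the part of the rent not attributed to any good. The sum compensates for the
  -- prices `ρ i (y i)` subtracted in the threshold rents.
  refine ⟨y, fun t => W (n + 1) t + ∑ i ∈ Finset.range (n + 1), ρ i (y i), ?_, ?_, ?_, ?_⟩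
  · intro i j hij hj
    induction j, hij using Nat.le_induction with
    | base => exact le_rfl
    | succ k hk ih => exact (ih (by omega)).trans (hys k (by omega))
  · intro t t' ht
    have := (hc' (n + 1) le_rfl).min t (c (n + 1) t') (ht.trans ((hc (n + 1)).le t'))
    simp only [hW]
    linarith
  · have h1 := hUle ⊥
    have h2 : ∑ i ∈ Finset.range (n + 1), ρ i (c (i + 1) ⊥) ≤
        ∑ i ∈ Finset.range (n + 1), ρ i (y i) := Finset.sum_le_sum fun i hi =>
      hρ.monotone i (by have := Finset.mem_range.1 hi; omega) ((hy i).1 (mem_insert _ _))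
    linarith
  · intro t hty
    obtain ⟨j, hj, hSj, hIC⟩ := hS t
    -- A type holding level `j` already minimizes `U - η j` above itself, hence also `U - η (i +
    -- 1)`, whose subtracted part grows more slowly. Goods below level `j` thus go only to fixed
    -- points.
    have hfix : ∀ i < j, c (i + 1) t = t := fun i hi => by
      refine (hc' (i + 1) (by omega)).eq_self fun t' ht' => ?_
      have h1 := hIC t' ht'
      have h2 := hηd (i + 1) j hi hj t t' ht'
      change U t + η j t' - η j t ≤ U t' at h1
      linarith
    have h1 : ∑ k ∈ Finset.range j, ρ k t ≤
        ∑ i ∈ Finset.range (n + 1), (if c (i + 1) t = t then ρ i t else 0) := by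
      calc ∑ k ∈ Finset.range j, ρ k t
          = ∑ i ∈ Finset.range j, (if c (i + 1) t = t then ρ i t else 0) :=
            Finset.sum_congr rfl fun i hi => by rw [if_pos (hfix i (Finset.mem_range.1 hi))]
        _ ≤ _ := by
            refine Finset.sum_le_sum_of_subset_of_nonneg
              (Finset.range_subset_range.2 hj) fun i hi _ => ?_
            split_ifs
            · exact hρ.nonneg i (by have := Finset.mem_range.1 hi; omega) t
            · exact le_rfl
    have h2 := Finset.sum_le_sum (s := Finset.range (n + 1)) fun i hi =>
      layer_le hw (hρ.monotone i (by have := Finset.mem_range.1 hi; omega))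
        (hρ.nonneg i (by have := Finset.mem_range.1 hi; omega)) (hc (i + 1)).le
        (hc (i + 1)).monotone (hc (i + 1)).idem (hy i)
        (hty i (by have := Finset.mem_range.1 hi; omega))
    simp only [Finset.sum_add_distrib, ← Finset.mul_sum, Finset.sum_sub_distrib] at h2 ⊢
    -- The factor `w t - 1` has no fixed sign: `h3` is weighted by `w t`, and `h4` by `1`, which
    -- costs the second `ε`.
    have h3 := hUle t
    have h4 := hUge t
    have h5 := hw0 t
    nlinarith

end LeastArgmin

open Classical in
theorem monotone_threshold {T : Type*} [LinearOrder T] {ρ : T → ℝ} (hρ : Monotone ρ) (hρ0 : ∀ t, 0 ≤ ρ t) (y : T) :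
    Monotone fun t => if y ≤ t then ρ t else 0 := by
  intro t t' h
  simp only
  split_ifs with h1 h2 h2
  · exact hρ h
  · exact absurd (h1.trans h) h2
  · exact hρ0 _
  · exact le_rfl

theorem monotone_rent {T : Type*} [LinearOrder T] {ρ : T → ℝ} (hρ : Monotone ρ) (y : T) :
    Monotone fun t => ρ (max t y) - ρ y := fun _ _ h =>
  sub_le_sub_right (hρ (max_le_max_right y h)) _

/-! ### Integrals over types and posted prices for a single good. -/

section Threshold

variable {T : Type*} [LinearOrder T] [BoundedOrder T] [TopologicalSpace T] [OrderTopology T]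
  [MeasurableSpace T] [BorelSpace T] {ν : Measure T}

theorem integrable_antitone_sub_one_mul {w m : T → ℝ} (hw : Antitone w)
    (hm : Integrable m ν) : Integrable (fun t => (w t - 1) * m t) ν := by
  refine hm.bdd_mul (c := |w ⊥ - 1| + |w ⊤ - 1|)
    (hw.measurable.sub_const 1).aestronglyMeasurable (Filter.Eventually.of_forall fun t => ?_)
  rw [Real.norm_eq_abs, abs_le]
  have h1 := hw (bot_le : ⊥ ≤ t)
  have h2 := hw (le_top : t ≤ ⊤)
  constructor <;> linarith [neg_abs_le (w ⊤ - 1), le_abs_self (w ⊥ - 1),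
    abs_nonneg (w ⊥ - 1), abs_nonneg (w ⊤ - 1)]

/-- On uniformly bounded monotone functions, integration against an integrable weight is
continuous for pointwise convergence. -/
theorem continuousOn_integral_mul_monotone [SecondCountableTopology T] [DenselyOrdered T]
    [NullSingletonClass ν] {g : T → ℝ} (hg : Integrable g ν) (C : ℝ) :
    ContinuousOn (fun m : T → ℝ => ∫ t, m t * g t ∂ν)
      {m | Monotone m ∧ ∀ t, |m t| ≤ C} := by
  intro m₀ hm₀
  obtain ⟨Q, hQc, hQd⟩ := TopologicalSpace.exists_countable_dense T
  have : Countable Q := hQc.to_subtype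
  -- Dominated convergence needs a countably generated filter, which pointwise neighbourhoods need
  -- not be. Convergence on a countable dense set suffices for monotone functions, at continuity
  -- points of the limit other than the two ends.
  let l : Filter (T → ℝ) := Filter.comap (fun m (q : Q) => m q) (nhds fun q : Q => m₀ q) ⊓
    Filter.principal {m | Monotone m ∧ ∀ t, |m t| ≤ C}
  have hl : nhdsWithin m₀ {m | Monotone m ∧ ∀ t, |m t| ≤ C} ≤ l :=
    inf_le_inf_right _ (Filter.tendsto_iff_comap.1
      ((continuous_pi fun q : Q => continuous_apply (q : T)).tendsto m₀))
  have hmem : ∀ᶠ m in l, Monotone m ∧ ∀ t, |m t| ≤ C :=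
    Filter.mem_inf_of_right (Filter.mem_principal_self _)
  refine Filter.Tendsto.mono_left ?_ hl
  refine tendsto_integral_filter_of_dominated_convergence (fun t => C * |g t|) ?_ ?_
    (hg.abs.const_mul C) ?_
  · filter_upwards [hmem] with m hm
    exact hm.1.measurable.aestronglyMeasurable.mul hg.aestronglyMeasurable
  · filter_upwards [hmem] with m hm
    refine Filter.Eventually.of_forall fun t => ?_
    rw [norm_mul]
    exact mul_le_mul_of_nonneg_right (hm.2 t) (norm_nonneg _)
  · have hae : ∀ᵐ t ∂ν, t ∉ {x | ¬ContinuousAt m₀ x} ∪ {⊥, ⊤} :=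
      measure_eq_zero_iff_ae_notMem.1 (Set.Countable.measure_zero
        (hm₀.1.countable_not_continuousAt.union (Set.toFinite _).countable) ν)
    filter_upwards [hae] with t ht
    simp only [mem_union, mem_ofPred_eq, mem_insert_iff, mem_singleton_iff, not_or,
      not_not] at ht
    obtain ⟨hcont, hbot, htop⟩ := ht
    refine Filter.Tendsto.mul_const _ ?_
    have hq : ∀ q ∈ Q, Filter.Tendsto (fun m : T → ℝ => m q) l (nhds (m₀ q)) := fun q hq =>
      Filter.Tendsto.comp (g := fun p : Q → ℝ => p ⟨q, hq⟩)
        (f := fun (m : T → ℝ) (q : Q) => m q) ((continuous_apply (⟨q, hq⟩ : Q)).tendsto _)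
        (Filter.tendsto_comap.mono_left inf_le_left)
    refine tendsto_order.2 ⟨fun x hx => ?_, fun x hx => ?_⟩
    · obtain ⟨s, hs, hs'⟩ := exists_Ioc_subset_of_mem_nhds (hcont.eventually (lt_mem_nhds hx))
        ⟨⊥, bot_lt_iff_ne_bot.2 hbot⟩
      obtain ⟨q, hqQ, hq1, hq2⟩ := hQd.exists_between hs
      filter_upwards [hmem, (hq q hqQ).eventually (lt_mem_nhds (hs' ⟨hq1, hq2.le⟩))] with m hm h
      exact lt_of_lt_of_le h (hm.1 hq2.le)
    · obtain ⟨s, hs, hs'⟩ := exists_Ico_subset_of_mem_nhds (hcont.eventually (gt_mem_nhds hx))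
        ⟨⊤, lt_top_iff_ne_top.2 htop⟩
      obtain ⟨q, hqQ, hq1, hq2⟩ := hQd.exists_between hs
      filter_upwards [hmem, (hq q hqQ).eventually (gt_mem_nhds (hs' ⟨hq1.le, hq2⟩))] with m hm h
      exact lt_of_le_of_lt (hm.1 hq1.le) h

variable [IsProbabilityMeasure ν]

theorem _root_.Monotone.integrable_of_boundedOrder {m : T → ℝ} (hm : Monotone m) :
    Integrable m ν := by
  refine Integrable.of_bound hm.measurable.aestronglyMeasurable (|m ⊥| + |m ⊤|)
    (Filter.Eventually.of_forall fun t => ?_)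
  rw [Real.norm_eq_abs, abs_le]
  have h1 := hm (bot_le : ⊥ ≤ t)
  have h2 := hm (le_top : t ≤ ⊤)
  constructor <;> linarith [neg_abs_le (m ⊥), le_abs_self (m ⊤), abs_nonneg (m ⊥),
    abs_nonneg (m ⊤)]

/-- Transfers that increase with the type do not raise the weighted welfare net of their cost. -/
theorem integral_sub_one_mul_nonpos {w D : T → ℝ} (hw : Antitone w) (hw1 : ∫ t, w t ∂ν ≤ 1)
    (hD : Monotone D) (hD0 : 0 ≤ D ⊥) : ∫ t, (w t - 1) * D t ∂ν ≤ 0 := by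
  have hwi : Integrable w ν := by
    have := (hw.neg.integrable_of_boundedOrder (ν := ν)).neg
    simpa using this
  -- `w - 1` changes sign at most once, from above. Taking for `d` the supremum of `D` where `w ≥ 1`
  -- bounds both sides of the crossing.
  obtain ⟨d, hd0, hd⟩ : ∃ d : ℝ, 0 ≤ d ∧ ∀ t, (w t - 1) * D t ≤ (w t - 1) * d := by
    by_cases hne : ∃ s, 1 ≤ w s
    · obtain ⟨s₀, hs₀⟩ := hne
      have hbdd : BddAbove (D '' {t | 1 ≤ w t}) :=
        ⟨D ⊤, by rintro _ ⟨t, _, rfl⟩; exact hD le_top⟩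
      refine ⟨sSup (D '' {t | 1 ≤ w t}), ?_, fun t => ?_⟩
      · exact (hD0.trans (hD bot_le)).trans (le_csSup hbdd ⟨s₀, hs₀, rfl⟩)
      · rcases le_or_gt 1 (w t) with h | h
        · exact mul_le_mul_of_nonneg_left (le_csSup hbdd ⟨t, h, rfl⟩) (by linarith)
        · refine mul_le_mul_of_nonpos_left ?_ (by linarith)
          refine csSup_le ⟨_, s₀, hs₀, rfl⟩ ?_
          rintro _ ⟨s, hs, rfl⟩
          refine hD (le_of_not_ge fun hts => ?_)
          exact absurd (hw hts) (not_le.2 (h.trans_le hs))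
    · push Not at hne
      refine ⟨0, le_rfl, fun t => ?_⟩
      rw [mul_zero]
      exact mul_nonpos_of_nonpos_of_nonneg (by linarith [hne t]) (hD0.trans (hD bot_le))
  calc ∫ t, (w t - 1) * D t ∂ν ≤ ∫ t, (w t - 1) * d ∂ν :=
        integral_mono (integrable_antitone_sub_one_mul hw hD.integrable_of_boundedOrder)
          (integrable_antitone_sub_one_mul hw (integrable_const d)) hd
    _ = (∫ t, w t ∂ν - 1) * d := by
        rw [integral_mul_const, integral_sub hwi (integrable_const 1)]
        simp
    _ ≤ 0 := mul_nonpos_of_nonpos_of_nonneg (by linarith) hd0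

open Classical in
/-- The objective generated by a good of value `ρ` that is sold at the reservation value of the
type `y`. -/
noncomputable def thresholdValue (ν : Measure T) (w ρ : T → ℝ) (y : T) : ℝ :=
  ∫ t, ((if y ≤ t then ρ t else 0) + (w t - 1) * (ρ (max t y) - ρ y)) ∂ν

open Classical in
theorem integrable_threshold {w ρ : T → ℝ} (hw : Antitone w) (hρ : Monotone ρ)
    (hρ0 : ∀ t, 0 ≤ ρ t) (y : T) :
    Integrable (fun t => (if y ≤ t then ρ t else 0) + (w t - 1) * (ρ (max t y) - ρ y)) ν :=
  (monotone_threshold hρ hρ0 y).integrable_of_boundedOrder.add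
    (integrable_antitone_sub_one_mul hw (monotone_rent hρ y).integrable_of_boundedOrder)

theorem integral_le_sum_thresholdValue [CompactSpace T] [NullSingletonClass ν] {n : ℕ}
    {ρ : ℕ → T → ℝ} (hρ : IsLayered n ρ)
    (hρc : ∀ i ≤ n, Continuous (ρ i)) {w S U : T → ℝ} {ε : ℝ}
    (hw : Antitone w) (hw0 : ∀ t, 0 ≤ w t) (hw1 : ∫ t, w t ∂ν ≤ 1) (hU : Continuous U)
    (hUm : Monotone U) (hU0 : 0 ≤ U ⊥) (hSi : Integrable S ν) (hε : ρ n ⊤ ≤ ε)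
    (hS : ∀ t, ∃ j ≤ n + 1, S t ≤ ∑ k ∈ Finset.range j, ρ k t + ε ∧
      ∀ t', t ≤ t' → U t + ∑ k ∈ Finset.range j, ρ k t' - ∑ k ∈ Finset.range j, ρ k t ≤ U t') :
    ∃ y : ℕ → T, (∀ i j, i ≤ j → j ≤ n → y i ≤ y j) ∧
      ∫ t, (S t + (w t - 1) * U t) ∂ν ≤
        ∑ i ∈ Finset.range (n + 1), thresholdValue ν w (ρ i) (y i) + 2 * ε := by
  classical
  obtain ⟨y, D, hy, hD, hD0, hle⟩ := exists_thresholds hρ hρc hw hw0 hU hUm hU0 hε hS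
  refine ⟨y, hy, ?_⟩
  have hi : ∀ i ∈ Finset.range (n + 1), Integrable (fun t => (if y i ≤ t then ρ i t else 0) +
      (w t - 1) * (ρ i (max t (y i)) - ρ i (y i))) ν := fun i hi =>
    integrable_threshold hw (hρ.monotone i (by have := Finset.mem_range.1 hi; omega))
      (hρ.nonneg i (by have := Finset.mem_range.1 hi; omega)) _
  have hDi : Integrable (fun t => (w t - 1) * D t) ν :=
    integrable_antitone_sub_one_mul hw hD.integrable_of_boundedOrder
  have hae : ∀ᵐ t ∂ν, ∀ i ≤ n, t ≠ y i := by
    have h1 : ∀ᵐ t ∂ν, ∀ i, t ≠ y i := ae_all_iff.2 fun i => by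
      rw [ae_iff]
      simp
    filter_upwards [h1] with t ht i _ using ht i
  have hsi : Integrable (fun t => ∑ i ∈ Finset.range (n + 1), ((if y i ≤ t then ρ i t else 0) +
      (w t - 1) * (ρ i (max t (y i)) - ρ i (y i)))) ν := integrable_finsetSum _ hi
  have hsDi : Integrable (fun t => ∑ i ∈ Finset.range (n + 1),
      ((if y i ≤ t then ρ i t else 0) + (w t - 1) * (ρ i (max t (y i)) - ρ i (y i))) +
      (w t - 1) * D t) ν := hsi.add hDi
  calc ∫ t, (S t + (w t - 1) * U t) ∂ν
      ≤ ∫ t, (∑ i ∈ Finset.range (n + 1), ((if y i ≤ t then ρ i t else 0) +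
          (w t - 1) * (ρ i (max t (y i)) - ρ i (y i))) + (w t - 1) * D t + 2 * ε) ∂ν := by
        refine integral_mono_ae
          (hSi.add (integrable_antitone_sub_one_mul hw hUm.integrable_of_boundedOrder))
          (hsDi.add (integrable_const _)) ?_
        filter_upwards [hae] with t ht using hle t ht
    _ = ∑ i ∈ Finset.range (n + 1), thresholdValue ν w (ρ i) (y i) +
          ∫ t, (w t - 1) * D t ∂ν + 2 * ε := by
        rw [integral_add hsDi (integrable_const _), integral_add hsi hDi, integral_finsetSum _ hi]
        simp [thresholdValue]
    _ ≤ _ := by linarith [integral_sub_one_mul_nonpos hw hw1 hD hD0]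

theorem exists_max_thresholdValue [CompactSpace T] [SecondCountableTopology T]
    [NullSingletonClass ν]
    {w ρ : T → ℝ} (hw : Antitone w) (hρ : Monotone ρ) (hρ0 : ∀ t, 0 ≤ ρ t)
    (hρc : Continuous ρ) :
    ∃ y, ∀ z, thresholdValue ν w ρ z ≤ thresholdValue ν w ρ y := by
  classical
  suffices h : Continuous (thresholdValue ν w ρ) by
    obtain ⟨y, -, hy⟩ := isCompact_univ.exists_isMaxOn ⟨⊥, mem_univ _⟩ h.continuousOn
    exact ⟨y, fun z => hy (mem_univ z)⟩
  refine continuous_iff_continuousAt.2 fun y₀ => ?_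
  refine continuousAt_of_dominated (bound := fun t => ρ ⊤ + |w t - 1| * ρ ⊤)
    (Filter.Eventually.of_forall fun y =>
      (integrable_threshold hw hρ hρ0 y).aestronglyMeasurable)
    (Filter.Eventually.of_forall fun y => Filter.Eventually.of_forall fun t => ?_) ?_ ?_
  · refine (norm_add_le _ _).trans (add_le_add ?_ ?_)
    · split_ifs
      · rw [Real.norm_of_nonneg (hρ0 _)]
        exact hρ le_top
      · simpa using hρ0 ⊤
    · rw [norm_mul, Real.norm_eq_abs, Real.norm_eq_abs]
      refine mul_le_mul_of_nonneg_left ?_ (abs_nonneg _)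
      have h1 := hρ (le_max_right t y)
      have h2 := hρ (le_top : max t y ≤ ⊤)
      rw [abs_of_nonneg (by linarith)]
      linarith [hρ0 y]
  · refine (integrable_const _).add (Integrable.mul_const ?_ _)
    have := integrable_antitone_sub_one_mul (ν := ν) hw (integrable_const (1 : ℝ))
    simpa using this.abs
  -- For fixed `t` the integrand can jump in the threshold only at `t` itself.
  · have hae : ∀ᵐ t ∂ν, t ≠ y₀ := by
      rw [ae_iff]
      simp
    filter_upwards [hae] with t ht
    refine ContinuousAt.add ?_ (by fun_prop)
    rcases lt_or_gt_of_ne ht with h | h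
    · refine (continuousAt_const (y := (0 : ℝ))).congr ?_
      filter_upwards [lt_mem_nhds h] with y hy
      rw [if_neg (not_le.2 hy)]
    · refine (continuousAt_const (y := ρ t)).congr ?_
      filter_upwards [gt_mem_nhds h] with y hy
      rw [if_pos (le_of_lt hy)]

end Threshold

/-! ### The one-dimensional screening problem. -/

section Screening

variable {T : Type*} [LinearOrder T] [TopologicalSpace T]

/-- The value `h α t` of the allocation `α ∈ [0, 1]` to the type `t` is increasing and convex in
the allocation, and its increments in the allocation are supermodular and log-supermodular. -/
structure IsScreening (h : unitInterval → T → ℝ) : Prop where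
  zero : ∀ t, h 0 t = 0
  monotone_left : ∀ t, Monotone fun α => h α t
  continuous_left : ∀ t, Continuous fun α => h α t
  continuous_right : ∀ α, Continuous (h α)
  supermodular : ∀ α β, α ≤ β → Monotone fun t => h β t - h α t
  convex : ∀ t, ∀ α β γ : unitInterval, α ≤ β → (γ : ℝ) - β = β - α →
    h β t - h α t ≤ h γ t - h β t
  cross : ∀ α β γ : unitInterval, α ≤ β → β ≤ γ → ∀ t t', t ≤ t' →
    (h β t' - h α t') * (h γ t - h β t) ≤ (h β t - h α t) * (h γ t' - h β t')

/-- The point `i / (n + 1)` of the unit interval. -/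
noncomputable def gridPoint (n i : ℕ) : unitInterval :=
  projIcc 0 1 zero_le_one ((i : ℝ) / (n + 1))

theorem coe_gridPoint {n i : ℕ} (hi : i ≤ n + 1) : (gridPoint n i : ℝ) = i / (n + 1) := by
  have h1 : (i : ℝ) ≤ n + 1 := by exact_mod_cast hi
  rw [gridPoint, projIcc_of_mem zero_le_one
    ⟨by positivity, (div_le_one (by positivity)).2 h1⟩]

theorem gridPoint_mono (n : ℕ) : Monotone (gridPoint n) := fun i j hij =>
  monotone_projIcc _ (by gcongr)

theorem gridPoint_zero (n : ℕ) : gridPoint n 0 = 0 := Subtype.ext (by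
  rw [coe_gridPoint (Nat.zero_le _)]; simp)

theorem gridPoint_last (n : ℕ) : gridPoint n (n + 1) = 1 := Subtype.ext (by
  rw [coe_gridPoint le_rfl]; push_cast; exact div_self (by positivity))

theorem tendsto_gridPoint_self :
    Filter.Tendsto (fun n => gridPoint n n) Filter.atTop (nhds 1) := by
  refine tendsto_subtype_rng.2 ?_
  simp only [coe_gridPoint (Nat.le_succ _)]
  exact tendsto_natCast_div_add_atTop (1 : ℝ)

namespace IsScreening

variable {h : unitInterval → T → ℝ}

/-- The increments of `h` along the grid. -/
noncomputable def increment (h : unitInterval → T → ℝ) (n i : ℕ) (t : T) : ℝ :=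
  h (gridPoint n (i + 1)) t - h (gridPoint n i) t

theorem sum_increment (hh : IsScreening h) (n j : ℕ) (t : T) :
    ∑ i ∈ Finset.range j, increment h n i t = h (gridPoint n j) t := by
  simp only [increment]
  rw [Finset.sum_range_sub (fun i => h (gridPoint n i) t), gridPoint_zero, hh.zero, sub_zero]

theorem increment_nonneg (hh : IsScreening h) (n i : ℕ) (t : T) : 0 ≤ increment h n i t :=
  sub_nonneg.2 (hh.monotone_left t (gridPoint_mono n (Nat.le_succ i)))

theorem increment_monotone (hh : IsScreening h) (n i : ℕ) : Monotone (increment h n i) :=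
  hh.supermodular _ _ (gridPoint_mono n (Nat.le_succ i))

theorem monotone_right (hh : IsScreening h) (α : unitInterval) : Monotone (h α) := by
  have := hh.supermodular 0 α bot_le
  simpa only [hh.zero, sub_zero] using this

theorem nonneg (hh : IsScreening h) (α : unitInterval) (t : T) : 0 ≤ h α t :=
  (hh.zero t).symm.le.trans (hh.monotone_left t bot_le)

theorem isLayered (hh : IsScreening h) (n : ℕ) : IsLayered n (increment h n) where
  nonneg i _ := hh.increment_nonneg n i
  monotone i _ := hh.increment_monotone n i
  le_succ i hi t := by
    refine hh.convex t _ _ _ (gridPoint_mono n (Nat.le_succ i)) ?_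
    rw [coe_gridPoint (by omega), coe_gridPoint (by omega), coe_gridPoint (by omega)]
    push_cast
    ring
  cross i _ t t' ht := hh.cross _ _ _ (gridPoint_mono n (Nat.le_succ i))
    (gridPoint_mono n (Nat.le_succ (i + 1))) t t' ht

theorem tendsto_increment_last [BoundedOrder T] (hh : IsScreening h) :
    Filter.Tendsto (fun n => increment h n n ⊤) Filter.atTop (nhds 0) := by
  have h1 := ((hh.continuous_left ⊤).tendsto 1).comp tendsto_gridPoint_self
  have h2 := h1.const_sub (h 1 ⊤)
  simp only [sub_self] at h2
  refine h2.congr fun n => ?_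
  simp only [increment, gridPoint_last, Function.comp]

variable [BoundedOrder T] [OrderTopology T] [MeasurableSpace T] [BorelSpace T] [CompactSpace T]
  {ν : Measure T} [IsProbabilityMeasure ν] [NullSingletonClass ν]

/-- Allocations are rounded down to the grid. Supermodularity preserves the deterrence of imitation,
and by convexity the surplus lost is at most the last increment at the top type. -/
theorem integral_le_sum (hh : IsScreening h) {w S U : T → ℝ} (hw : Antitone w)
    (hw0 : ∀ t, 0 ≤ w t) (hw1 : ∫ t, w t ∂ν ≤ 1) (hU : Continuous U)
    (hUm : Monotone U) (hU0 : 0 ≤ U ⊥) (hSi : Integrable S ν)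
    (hS : ∀ t, ∃ β, S t = h β t ∧ ∀ t', t ≤ t' → U t + h β t' - h β t ≤ U t') (n : ℕ) :
    ∃ y : ℕ → T, (∀ i j, i ≤ j → j ≤ n → y i ≤ y j) ∧
      ∫ t, (S t + (w t - 1) * U t) ∂ν ≤
        ∑ i ∈ Finset.range (n + 1), thresholdValue ν w (increment h n i) (y i) +
          2 * increment h n n ⊤ := by
  refine integral_le_sum_thresholdValue (hh.isLayered n)
    (fun i _ => (hh.continuous_right _).sub (hh.continuous_right _)) hw hw0 hw1 hU hUm hU0 hSi
    le_rfl fun t => ?_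
  obtain ⟨β, hSβ, hIC⟩ := hS t
  have hβ0 : (0 : ℝ) ≤ β := β.2.1
  have hβ1 : (β : ℝ) ≤ 1 := β.2.2
  have hn : (0 : ℝ) < n + 1 := by positivity
  set j := ⌊(β : ℝ) * (n + 1)⌋₊ with hj
  have hjle : (j : ℝ) ≤ β * (n + 1) := Nat.floor_le (by positivity)
  have hjlt : (β : ℝ) * (n + 1) < j + 1 := Nat.lt_floor_add_one _
  have hjn : j ≤ n + 1 := by
    have : (j : ℝ) ≤ (n + 1 : ℕ) := by push_cast; nlinarith
    exact_mod_cast this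
  have hgj : gridPoint n j ≤ β := by
    refine Subtype.coe_le_coe.1 ?_
    rw [coe_gridPoint hjn, div_le_iff₀ hn]
    exact hjle
  refine ⟨j, hjn, ?_, fun t' ht' => ?_⟩
  · rw [hh.sum_increment, hSβ]
    rcases hjn.eq_or_lt with h1 | h1
    · rw [h1, gridPoint_last]
      have h2 := hh.monotone_left t (show β ≤ 1 from le_top)
      have h3 := hh.increment_nonneg n n ⊤
      simp only at h2
      linarith
    · have h2 : β ≤ gridPoint n (j + 1) := by
        refine Subtype.coe_le_coe.1 ?_
        rw [coe_gridPoint h1, le_div_iff₀ hn]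
        push_cast
        exact hjlt.le
      have h3 := hh.monotone_left t h2
      have h4 : increment h n j t ≤ increment h n n t := by
        have h5 : ∀ k, j ≤ k → k ≤ n → increment h n j t ≤ increment h n k t := by
          intro k hk
          induction k, hk using Nat.le_induction with
          | base => exact fun _ => le_rfl
          | succ k hk ih =>
            exact fun hkn => (ih (by omega)).trans ((hh.isLayered n).le_succ k (by omega) t)
        exact h5 n (by omega) le_rfl
      have h5 := hh.increment_monotone n n (le_top : t ≤ ⊤)
      simp only [increment] at h3 h4 h5 ⊢
      linarith
  · rw [hh.sum_increment, hh.sum_increment]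
    have h1 := hIC t' ht'
    have h2 := hh.supermodular _ _ hgj ht'
    simp only at h2
    linarith

end IsScreening

theorem eq_range_card {s : Finset ℕ} (hs : ∀ i j, i ≤ j → j ∈ s → i ∈ s) :
    s = Finset.range s.card := by
  refine Finset.eq_of_subset_of_card_le (fun i hi => Finset.mem_range.2 ?_) (by simp)
  have h1 : Finset.range (i + 1) ⊆ s := fun k hk =>
    hs k i (by have := Finset.mem_range.1 hk; omega) hi
  simpa using Finset.card_le_card h1

namespace IsScreening

variable {h : unitInterval → T → ℝ}

theorem surplus_monotone (hh : IsScreening h) {α : T → unitInterval} (hα : Monotone α) :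
    Monotone fun t => h (α t) t := fun t _ ht =>
  (hh.monotone_left t (hα ht)).trans (hh.monotone_right _ ht)

variable [BoundedOrder T]

/-- Monotone allocations together with bounded utilities for which truth-telling is optimal. -/
def implementable (h : unitInterval → T → ℝ) : Set ((T → unitInterval) × (T → ℝ)) :=
  {p | Monotone p.1 ∧ (∀ t, p.2 t ∈ Icc 0 (h 1 ⊤)) ∧
    ∀ t t', p.2 t + h (p.1 t) t' - h (p.1 t) t ≤ p.2 t'}

/-- For pointwise convergence the constraints are closed conditions inside a product of compact
intervals. -/
theorem isCompact_implementable (hh : IsScreening h) : IsCompact (implementable h) := by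
  have h1 : IsCompact ((univ : Set (T → unitInterval)) ×ˢ
      (univ.pi fun _ : T => Icc (0 : ℝ) (h 1 ⊤))) :=
    isCompact_univ.prod (isCompact_univ_pi fun _ => isCompact_Icc)
  refine h1.of_isClosed_subset ?_ fun p hp => ⟨mem_univ _, fun t _ => hp.2.1 t⟩
  have e : implementable h = {p | Monotone p.1} ∩ ((⋂ t, {p | p.2 t ∈ Icc 0 (h 1 ⊤)}) ∩
      ⋂ t, ⋂ t', {p | p.2 t + h (p.1 t) t' - h (p.1 t) t ≤ p.2 t'}) := by
    ext p
    simp [implementable]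
  rw [e]
  refine (isClosed_monotone.preimage continuous_fst).inter
    ((isClosed_iInter fun t => isClosed_Icc.preimage
      ((continuous_apply t).comp continuous_snd)).inter
    (isClosed_iInter fun t => isClosed_iInter fun t' => isClosed_le ?_ ?_))
  · have h2 := ((continuous_apply t).comp
      (continuous_fst (X := T → unitInterval) (Y := T → ℝ)))
    exact (((continuous_apply t).comp continuous_snd).add
      ((hh.continuous_left t').comp h2)).sub ((hh.continuous_left t).comp h2)
  · exact (continuous_apply t').comp continuous_snd

theorem utility_monotone (hh : IsScreening h) {p : (T → unitInterval) × (T → ℝ)}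
    (hp : p ∈ implementable h) : Monotone p.2 := fun t t' ht => by
  have h1 := hp.2.2 t t'
  have h2 := hh.monotone_right (p.1 t) ht
  linarith

variable [OrderTopology T] [MeasurableSpace T] [BorelSpace T] {ν : Measure T}
  [IsProbabilityMeasure ν]

theorem exists_implementable_of_thresholds (hh : IsScreening h) {w : T → ℝ} (hw : Antitone w)
    {n : ℕ} {y : ℕ → T} (hy : ∀ i j, i ≤ j → j ≤ n → y i ≤ y j) :
    ∃ p ∈ implementable h, ∫ t, (h (p.1 t) t + (w t - 1) * p.2 t) ∂ν =
      ∑ i ∈ Finset.range (n + 1), thresholdValue ν w (increment h n i) (y i) := by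
  classical
  -- Ordered thresholds make the set of goods bought by `t` an initial segment, so its cardinality
  -- is a grid level. Incentive constraints then hold good by good and add up.
  let F : T → Finset ℕ := fun t => (Finset.range (n + 1)).filter fun i => y i ≤ t
  have hF : ∀ t, F t = Finset.range (F t).card := fun t => eq_range_card fun i j hij hj => by
    simp only [F, Finset.mem_filter, Finset.mem_range] at hj ⊢
    exact ⟨by omega, (hy i j hij (by omega)).trans hj.2⟩
  have hval : ∀ t s, h (gridPoint n (F t).card) s =
      ∑ i ∈ Finset.range (n + 1), if y i ≤ t then increment h n i s else 0 := fun t s => by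
    rw [← hh.sum_increment, ← hF, Finset.sum_filter]
  let U : T → ℝ := fun t => ∑ i ∈ Finset.range (n + 1),
    (increment h n i (max t (y i)) - increment h n i (y i))
  refine ⟨(fun t => gridPoint n (F t).card, U), ⟨fun t t' ht => gridPoint_mono n
    (Finset.card_le_card fun i hi => ?_), fun t => ⟨?_, ?_⟩,
    fun t t' => ?_⟩, ?_⟩
  · simp only [F, Finset.mem_filter] at hi ⊢
    exact ⟨hi.1, hi.2.trans ht⟩
  · change 0 ≤ U t
    exact Finset.sum_nonneg fun i _ =>
      sub_nonneg.2 (hh.increment_monotone n i (le_max_right _ _))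
  · have h1 := hh.sum_increment n (n + 1) ⊤
    rw [gridPoint_last] at h1
    rw [← h1]
    change U t ≤ _
    refine Finset.sum_le_sum fun i _ => ?_
    have h2 := hh.increment_monotone n i (le_top : max t (y i) ≤ ⊤)
    have h3 := hh.increment_nonneg n i (y i)
    linarith
  · simp only [hval, U]
    rw [← Finset.sum_add_distrib, ← Finset.sum_sub_distrib]
    refine Finset.sum_le_sum fun i _ => ?_
    have h1 := hh.increment_monotone n i (le_max_left t' (y i))
    have h2 := hh.increment_monotone n i (le_max_right t' (y i))
    split_ifs with hi
    · rw [max_eq_left hi]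
      linarith
    · rw [max_eq_right (le_of_not_ge hi)]
      linarith
  · simp only [hval, U, Finset.mul_sum, ← Finset.sum_add_distrib]
    rw [integral_finsetSum _ fun i _ => integrable_threshold hw (hh.increment_monotone n i)
      (hh.increment_nonneg n i) _]
    simp only [thresholdValue]

variable [NullSingletonClass ν]

theorem exists_isMaxOn_implementable [SecondCountableTopology T] [DenselyOrdered T]
    (hh : IsScreening h) {w : T → ℝ} (hw : Antitone w) :
    ∃ p ∈ implementable h, IsMaxOn
      (fun p => ∫ t, (h (p.1 t) t + (w t - 1) * p.2 t) ∂ν) (implementable h) p := by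
  refine hh.isCompact_implementable.exists_isMaxOn
    ⟨(fun _ => 0, fun _ => 0), monotone_const, fun t => ⟨le_rfl, hh.nonneg _ _⟩, by
      simp [hh.zero]⟩ ?_
  have hwi : Integrable (fun t => w t - 1) ν := by
    simpa using integrable_antitone_sub_one_mul (ν := ν) hw (integrable_const (1 : ℝ))
  have h1 := (continuousOn_integral_mul_monotone (ν := ν) (integrable_const (1 : ℝ))
    (h 1 ⊤)).comp (s := implementable h) (f := fun p t => h (p.1 t) t)
    (continuous_pi fun t => (hh.continuous_left t).comp
      ((continuous_apply t).comp continuous_fst)).continuousOn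
    fun p hp => ⟨hh.surplus_monotone (α := p.1) hp.1, fun t => by
      rw [abs_of_nonneg (hh.nonneg _ _)]
      exact (hh.monotone_left t le_top).trans (hh.monotone_right 1 le_top)⟩
  have h2 := (continuousOn_integral_mul_monotone (ν := ν) hwi
    (h 1 ⊤)).comp (s := implementable h) (f := fun p => p.2)
    continuous_snd.continuousOn
    fun p hp => ⟨hh.utility_monotone hp, fun t => by
      rw [abs_of_nonneg (hp.2.1 t).1]
      exact (hp.2.1 t).2⟩
  refine (h1.add h2).congr fun p hp => ?_
  change _ = ∫ t, h (p.1 t) t * 1 ∂ν + ∫ t, p.2 t * (w t - 1) ∂ν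
  simp_rw [mul_one, mul_comm (p.2 _)]
  exact integral_add (hh.surplus_monotone (α := p.1) hp.1).integrable_of_boundedOrder
    (integrable_antitone_sub_one_mul hw (hh.utility_monotone hp).integrable_of_boundedOrder)

/-- Some implementable monotone allocation is at least as good as every allocation that deters
imitation of lower types. -/
theorem exists_optimal [CompactSpace T] [SecondCountableTopology T] [DenselyOrdered T]
    (hh : IsScreening h) {w : T → ℝ} (hw : Antitone w) (hw0 : ∀ t, 0 ≤ w t)
    (hw1 : ∫ t, w t ∂ν ≤ 1) :
    ∃ p ∈ implementable h, ∀ S U : T → ℝ, Continuous U → Monotone U → 0 ≤ U ⊥ →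
      Integrable S ν →
      (∀ t, ∃ β, S t = h β t ∧ ∀ t', t ≤ t' → U t + h β t' - h β t ≤ U t') →
      ∫ t, (S t + (w t - 1) * U t) ∂ν ≤ ∫ t, (h (p.1 t) t + (w t - 1) * p.2 t) ∂ν := by
  obtain ⟨p, hp, hmax⟩ := hh.exists_isMaxOn_implementable (ν := ν) hw
  refine ⟨p, hp, fun S U hU hUm hU0 hSi hS => ?_⟩
  have h1 := (hh.tendsto_increment_last.const_mul 2).const_add
    (∫ t, (h (p.1 t) t + (w t - 1) * p.2 t) ∂ν)
  rw [mul_zero, add_zero] at h1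
  refine ge_of_tendsto h1 (Filter.Eventually.of_forall fun n => ?_)
  obtain ⟨y, hy, hle⟩ := hh.integral_le_sum hw hw0 hw1 hU hUm hU0 hSi hS n
  obtain ⟨q, hq, hqe⟩ := hh.exists_implementable_of_thresholds (ν := ν) hw hy
  have h2 := isMaxOn_iff.1 hmax q hq
  linarith

/-- When the value is linear in the allocation, some single threshold is at least as good as
every allocation that deters imitation of lower types. -/
theorem exists_optimal_threshold [CompactSpace T] [SecondCountableTopology T] {H : T → ℝ}
    (hH : Monotone H) (hH0 : ∀ t, 0 ≤ H t) (hHc : Continuous H) {w : T → ℝ} (hw : Antitone w)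
    (hw0 : ∀ t, 0 ≤ w t) (hw1 : ∫ t, w t ∂ν ≤ 1) :
    ∃ y, ∀ S U : T → ℝ, Continuous U → Monotone U → 0 ≤ U ⊥ → Integrable S ν →
      (∀ t, ∃ q : unitInterval, S t = q * H t ∧
        ∀ t', t ≤ t' → U t + q * H t' - q * H t ≤ U t') →
      ∫ t, (S t + (w t - 1) * U t) ∂ν ≤ thresholdValue ν w H y := by
  have hh : IsScreening fun (q : unitInterval) t => (q : ℝ) * H t := by
    refine ⟨by simp, fun t α β hαβ => mul_le_mul_of_nonneg_right hαβ (hH0 t),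
      fun t => by fun_prop, fun α => by fun_prop, fun α β hαβ t t' ht => ?_,
      fun t α β γ _ hγ => ?_, fun α β γ _ _ t t' _ => ?_⟩
    · simp only [← sub_mul]
      exact mul_le_mul_of_nonneg_left (hH ht) (sub_nonneg.2 hαβ)
    · rw [← sub_mul, ← sub_mul, hγ]
    · exact le_of_eq (by ring)
  obtain ⟨y, hy⟩ := exists_max_thresholdValue (ν := ν) hw hH hH0 hHc
  refine ⟨y, fun S U hU hUm hU0 hSi hS => ?_⟩
  have h1 := (hh.tendsto_increment_last.const_mul 2).const_add (thresholdValue ν w H y)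
  rw [mul_zero, add_zero] at h1
  refine ge_of_tendsto h1 (Filter.Eventually.of_forall fun n => ?_)
  obtain ⟨z, -, hle⟩ := hh.integral_le_sum hw hw0 hw1 hU hUm hU0 hSi hS n
  refine hle.trans (add_le_add_left ?_ _)
  have hn : (0 : ℝ) < n + 1 := by positivity
  -- Every increment equals `H / (n + 1)`, so the best threshold for `H` is best for each layer.
  calc _ ≤ ∑ i ∈ Finset.range (n + 1), (1 / ((n : ℝ) + 1)) * thresholdValue ν w H y := by
        refine Finset.sum_le_sum fun i hi => ?_
        have hi' := Finset.mem_range.1 hi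
        refine le_trans (le_of_eq ?_)
          (mul_le_mul_of_nonneg_left (hy (z i)) (by positivity))
        simp only [thresholdValue, increment, ← sub_mul]
        rw [coe_gridPoint (by omega), coe_gridPoint (by omega), ← integral_const_mul]
        congr 1
        ext t
        split_ifs <;> (push_cast; ring)
    _ = thresholdValue ν w H y := by
        rw [Finset.sum_const, Finset.card_range, nsmul_eq_mul]
        push_cast
        field_simp

end IsScreening

end Screening

/-! ### Symmetry: the prior is the worst belief and the vertices are the best. -/

section Beliefs

variable {Ω : Type*} [Fintype Ω] [Nonempty Ω] {a b : ℝ} {u : (Ω → ℝ) → ℝ → ℝ}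

theorem sum_perm_apply [DecidableEq Ω] (μ : stdSimplex ℝ Ω) :
    ∑ σ : Equiv.Perm Ω, (Fintype.card (Equiv.Perm Ω) : ℝ)⁻¹ • (μ.1 ∘ σ) = (prior Ω).1 := by
  have hc : (Fintype.card (Equiv.Perm Ω) : ℝ) ≠ 0 := by simp
  have hΩ : (Fintype.card Ω : ℝ) ≠ 0 := by simp
  have hconst : ∀ ω ω' : Ω, ∑ σ : Equiv.Perm Ω, μ.1 (σ ω) = ∑ σ : Equiv.Perm Ω, μ.1 (σ ω') :=
    fun ω ω' => Fintype.sum_equiv (Equiv.mulRight (Equiv.swap ω ω')) _ _ fun σ => by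
      simp [Equiv.Perm.mul_apply]
  have htot : ∑ ω : Ω, ∑ σ : Equiv.Perm Ω, μ.1 (σ ω) = Fintype.card (Equiv.Perm Ω) := by
    rw [Finset.sum_comm]
    simp_rw [Equiv.sum_comp _ μ.1]
    have : ∑ i, μ.1 i = 1 := μ.2.2
    simp [this]
  ext ω
  have h1 : (Fintype.card Ω : ℝ) * ∑ σ : Equiv.Perm Ω, μ.1 (σ ω) =
      Fintype.card (Equiv.Perm Ω) := by
    rw [← htot, Finset.sum_congr rfl fun ω' _ => hconst ω' ω]
    simp
  simp only [Finset.sum_apply, Pi.smul_apply, Function.comp, smul_eq_mul, ← Finset.mul_sum,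
    stdSimplex.barycenter_apply]
  field_simp
  linarith

/-- The prior is the average of all permutations of `μ`, which have equal utility; convexity
concludes. -/
theorem prior_le (hu : IsIndirectUtility a b u) (hsymm : IsSymmetricEnv a b u)
    (μ : stdSimplex ℝ Ω) {t : ℝ} (ht : t ∈ Icc a b) : u (prior Ω).1 t ≤ u μ.1 t := by
  classical
  have hc : (Fintype.card (Equiv.Perm Ω) : ℝ) ≠ 0 := by simp
  have h := (hu.convexOn t ht).map_sum_le (t := Finset.univ)
    (w := fun _ : Equiv.Perm Ω => (Fintype.card (Equiv.Perm Ω) : ℝ)⁻¹)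
    (p := fun σ => μ.1 ∘ σ) (fun _ _ => by positivity)
    (by simp [hc]) fun σ _ => ⟨fun ω => μ.2.1 _, by
      simp only [Function.comp]
      exact (Equiv.sum_comp σ μ.1).trans μ.2.2⟩
  rw [sum_perm_apply] at h
  simp_rw [hsymm _ μ.1 μ.2 t ht] at h
  simpa [hc] using h

variable [DecidableEq Ω]

theorem utility_single_eq (hsymm : IsSymmetricEnv a b u) (α : unitInterval) (ω ω' : Ω) {t : ℝ}
    (ht : t ∈ Icc a b) :
    u (truthOrNoiseBelief α ω).1 t = u (truthOrNoiseBelief α ω').1 t := by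
  rw [← hsymm (Equiv.swap ω ω') _ (truthOrNoiseBelief α ω').2 t ht]
  congr 1
  ext x
  simp only [truthOrNoiseBelief, Function.comp, Pi.add_apply, Pi.smul_apply, smul_eq_mul,
    stdSimplex.barycenter_apply, Pi.single_apply]
  congr 2
  simp only [Equiv.swap_apply_eq_iff, Equiv.swap_apply_right]

theorem truthOrNoiseBelief_zero (ω : Ω) : truthOrNoiseBelief 0 ω = prior Ω :=
  Subtype.ext (by simp [truthOrNoiseBelief])

theorem truthOrNoiseBelief_one (ω : Ω) : (truthOrNoiseBelief 1 ω).1 = Pi.single ω 1 := by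
  simp [truthOrNoiseBelief]

theorem continuous_truthOrNoiseBelief (ω : Ω) :
    Continuous fun α : unitInterval => truthOrNoiseBelief α ω :=
  Continuous.subtype_mk (by fun_prop) _

theorem le_vertex (hu : IsIndirectUtility a b u) (hsymm : IsSymmetricEnv a b u)
    (μ : stdSimplex ℝ Ω) (ω : Ω) {t : ℝ} (ht : t ∈ Icc a b) :
    u μ.1 t ≤ u (truthOrNoiseBelief 1 ω).1 t := by
  have h := (hu.convexOn t ht).map_sum_le (t := Finset.univ)
    (w := μ.1) (p := fun ω' => (truthOrNoiseBelief 1 ω').1) (fun ω' _ => μ.2.1 ω') μ.2.2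
    fun ω' _ => (truthOrNoiseBelief 1 ω').2
  have e : ∑ ω', μ.1 ω' • (truthOrNoiseBelief 1 ω').1 = μ.1 := by
    ext x
    simp [truthOrNoiseBelief_one, Finset.sum_apply, Pi.single_apply]
  rw [e] at h
  simp_rw [utility_single_eq hsymm 1 _ ω ht, smul_eq_mul, ← Finset.sum_mul] at h
  have h1 : ∑ i, μ.1 i = 1 := μ.2.2
  rwa [h1, one_mul] at h

end Beliefs

/-! ### Values of experiments. -/

section Value

variable {Ω : Type*} [Fintype Ω] [Nonempty Ω] {a b : ℝ} {u : (Ω → ℝ) → ℝ → ℝ}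

instance (γ : Experiment Ω) : IsProbabilityMeasure γ.law :=
  inferInstanceAs (IsProbabilityMeasure (γ.1 : Measure (stdSimplex ℝ Ω)))

theorem continuous_utility (hu : IsIndirectUtility a b u) {t : ℝ} (ht : t ∈ Icc a b) :
    Continuous fun μ : stdSimplex ℝ Ω => u μ.1 t :=
  continuousOn_iff_continuous_domRestrict.1 (hu.continuousOn t ht)

theorem integrable_utility (hu : IsIndirectUtility a b u) (γ : Experiment Ω) {t : ℝ}
    (ht : t ∈ Icc a b) : Integrable (fun μ : stdSimplex ℝ Ω => u μ.1 t) γ.law :=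
  (continuous_utility hu ht).integrable_of_hasCompactSupport
    (HasCompactSupport.of_compactSpace _)

theorem value_eq_integral (hu : IsIndirectUtility a b u) (γ : Experiment Ω) {t : ℝ}
    (ht : t ∈ Icc a b) :
    value u γ t = ∫ μ : stdSimplex ℝ Ω, (u μ.1 t - u (prior Ω).1 t) ∂γ.law := by
  rw [integral_sub (integrable_utility hu γ ht) (integrable_const _)]
  simp [value]

theorem integrable_gain (hu : IsIndirectUtility a b u) (γ : Experiment Ω) {t : ℝ}
    (ht : t ∈ Icc a b) :
    Integrable (fun μ : stdSimplex ℝ Ω => u μ.1 t - u (prior Ω).1 t) γ.law :=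
  (integrable_utility hu γ ht).sub (integrable_const _)

theorem gain_mono (hu : IsIndirectUtility a b u) (μ : stdSimplex ℝ Ω) {s t : ℝ}
    (hs : s ∈ Icc a b) (ht : t ∈ Icc a b) (hst : s ≤ t) :
    u μ.1 s - u (prior Ω).1 s ≤ u μ.1 t - u (prior Ω).1 t := by
  by_cases h : μ.1 = (prior Ω).1
  · simp [h]
  · exact (hu.strictMonoOn μ.1 μ.2 h).monotoneOn hs ht hst

theorem value_mono (hu : IsIndirectUtility a b u) (γ : Experiment Ω) {s t : ℝ}
    (hs : s ∈ Icc a b) (ht : t ∈ Icc a b) (hst : s ≤ t) : value u γ s ≤ value u γ t := by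
  rw [value_eq_integral hu γ hs, value_eq_integral hu γ ht]
  exact integral_mono (integrable_gain hu γ hs) (integrable_gain hu γ ht)
    fun μ => gain_mono hu μ hs ht hst

/-- The derivative in the type is bounded by compactness. Uniformity over beliefs makes the utility
in every feasible mechanism Lipschitz, as the running minima require continuity. -/
theorem exists_gain_lipschitz (hu : IsIndirectUtility a b u) :
    ∃ L : ℝ, ∀ μ : stdSimplex ℝ Ω, ∀ s ∈ Icc a b, ∀ t ∈ Icc a b,
      |(u μ.1 t - u (prior Ω).1 t) - (u μ.1 s - u (prior Ω).1 s)| ≤ L * |t - s| := by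
  obtain ⟨d, hd, hdc⟩ := hu.exists_deriv
  obtain ⟨L, hL⟩ := ((isCompact_stdSimplex ℝ Ω).prod isCompact_Icc).exists_bound_of_continuousOn
    hdc
  exact ⟨L, fun μ s hs t ht => Convex.norm_image_sub_le_of_norm_hasDerivWithin_le
    (hd μ.1 μ.2) (fun x hx => hL (μ.1, x) ⟨μ.2, hx⟩) (convex_Icc a b) hs ht⟩

theorem exists_value_lipschitz (hu : IsIndirectUtility a b u) :
    ∃ L : ℝ, ∀ γ : Experiment Ω, ∀ s ∈ Icc a b, ∀ t ∈ Icc a b,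
      |value u γ t - value u γ s| ≤ L * |t - s| := by
  obtain ⟨L, hL⟩ := exists_gain_lipschitz hu
  refine ⟨L, fun γ s hs t ht => ?_⟩
  rw [value_eq_integral hu γ hs, value_eq_integral hu γ ht,
    ← integral_sub (integrable_gain hu γ ht) (integrable_gain hu γ hs)]
  have h := norm_integral_le_of_norm_le_const (μ := γ.law)
    (f := fun μ => (u μ.1 t - u (prior Ω).1 t) - (u μ.1 s - u (prior Ω).1 s))
    (Filter.Eventually.of_forall fun μ => hL μ s hs t ht)
  simpa using h

theorem value_noInformation (t : ℝ) : value u (noInformation Ω) t = 0 := by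
  have : (noInformation Ω).law = Measure.dirac (prior Ω) := rfl
  rw [value, this, integral_dirac, sub_self]

theorem value_nonneg (hu : IsIndirectUtility a b u) (hsymm : IsSymmetricEnv a b u)
    (γ : Experiment Ω) {t : ℝ} (ht : t ∈ Icc a b) : 0 ≤ value u γ t := by
  rw [value_eq_integral hu γ ht]
  exact integral_nonneg fun μ => sub_nonneg.2 (prior_le hu hsymm μ ht)

variable [DecidableEq Ω]

theorem value_truthOrNoise (hsymm : IsSymmetricEnv a b u) (α : unitInterval) (ω : Ω) {t : ℝ}
    (ht : t ∈ Icc a b) :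
    value u (truthOrNoise Ω α) t =
      u (truthOrNoiseBelief α ω).1 t - u (prior Ω).1 t := by
  have hlaw : (truthOrNoise Ω α).law = truthOrNoiseLaw Ω α := rfl
  have hc : (Fintype.card Ω : ℝ) ≠ 0 := by simp
  rw [value, hlaw, truthOrNoiseLaw, integral_finsetSum_measure fun ω' _ =>
    (integrable_dirac (by simp)).smul_measure (by simp)]
  simp only [integral_smul_measure, integral_dirac, utility_single_eq hsymm α _ ω ht]
  simp [hc]

theorem value_le_fullInformation (hu : IsIndirectUtility a b u)
    (hsymm : IsSymmetricEnv a b u) (γ : Experiment Ω) {t : ℝ} (ht : t ∈ Icc a b) :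
    value u γ t ≤ value u (fullInformation Ω) t := by
  obtain ⟨ω⟩ := ‹Nonempty Ω›
  rw [fullInformation, value_truthOrNoise hsymm 1 ω ht, value]
  have h := integral_mono (integrable_utility hu γ ht)
    (integrable_const (u (truthOrNoiseBelief 1 ω).1 t)) fun μ => le_vertex hu hsymm μ ω ht
  simp only [integral_const, probReal_univ, one_smul] at h
  linarith

theorem measurable_truthOrNoise : Measurable (truthOrNoise Ω) := by
  refine Measurable.subtype_mk (Measurable.subtype_mk ?_)
  refine Measure.measurable_of_measurable_coe _ fun s hs => ?_
  simp only [truthOrNoiseLaw, Measure.coe_finsetSum, Finset.sum_apply, Measure.smul_apply,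
    smul_eq_mul]
  refine Finset.measurable_sum _ fun ω _ => Measurable.const_mul ?_ _
  exact (Measure.measurable_coe hs).comp
    (Measure.measurable_dirac.comp (continuous_truthOrNoiseBelief ω).measurable)

end Value

/-! ### The distribution of types. -/

section Law

variable {a b : ℝ} {f : Icc a b → ℝ}

/-- The distribution of types with density `f`. -/
noncomputable def typeLaw (f : Icc a b → ℝ) : Measure (Icc a b) :=
  (volume.comap Subtype.val).withDensity fun t => ENNReal.ofReal (f t)

theorem expect_eq_integral (hf : IsTypeDensity a b f) (φ : Icc a b → ℝ) :
    expect f φ = ∫ t, φ t ∂typeLaw f := by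
  rw [expect, typeLaw, integral_withDensity_eq_integral_toReal_smul
    hf.continuous.measurable.ennreal_ofReal (by simp)]
  simp only [ENNReal.toReal_ofReal (hf.pos _).le, smul_eq_mul, mul_comm]

theorem isProbabilityMeasure_typeLaw (hf : IsTypeDensity a b f) :
    IsProbabilityMeasure (typeLaw f) := by
  have hi : Integrable f (volume.comap Subtype.val) := by
    by_contra h
    have := hf.integral_eq_one
    rw [integral_undef h] at this
    exact zero_ne_one this
  constructor
  rw [typeLaw, withDensity_apply _ MeasurableSet.univ, Measure.restrict_univ,
    ← ofReal_integral_eq_lintegral_ofReal hi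
      (Filter.Eventually.of_forall fun t => (hf.pos t).le), hf.integral_eq_one,
    ENNReal.ofReal_one]

theorem nullSingletonClass_typeLaw : NullSingletonClass (typeLaw f) := by
  constructor
  intro t
  refine withDensity_absolutelyContinuous _ _ ?_
  rw [(MeasurableEmbedding.subtype_coe measurableSet_Icc).comap_apply]
  simp

end Law

/-! ### Feasible mechanisms in terms of surplus and rent. -/

section Mechanisms

variable {Ω : Type*} [Fintype Ω] [Nonempty Ω] {a b : ℝ} {u : (Ω → ℝ) → ℝ → ℝ}

namespace Mechanism

/-- The utility of the type `t` in the mechanism `M`. -/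
noncomputable def utility (u : (Ω → ℝ) → ℝ → ℝ) (M : Mechanism Ω a b) (t : Icc a b) : ℝ :=
  value u (M.alloc t) t - M.pay t

theorem IsFeasible.utility_ge {M : Mechanism Ω a b} (hM : M.IsFeasible u) (t t' : Icc a b) :
    M.utility u t + value u (M.alloc t) t' - value u (M.alloc t) t ≤ M.utility u t' := by
  have := hM.ic t' t
  simp only [utility]
  linarith

theorem IsFeasible.utility_monotone (hu : IsIndirectUtility a b u) {M : Mechanism Ω a b}
    (hM : M.IsFeasible u) : Monotone (M.utility u) := fun t t' ht => by
  have h1 := hM.utility_ge t t'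
  have h2 := value_mono hu (M.alloc t) t.2 t'.2 ht
  linarith

theorem IsFeasible.continuous_utility (hu : IsIndirectUtility a b u) {M : Mechanism Ω a b}
    (hM : M.IsFeasible u) : Continuous (M.utility u) := by
  obtain ⟨L, hL⟩ := exists_value_lipschitz hu
  have h1 : ∀ t t' : Icc a b, M.utility u t - M.utility u t' ≤ L * |(t : ℝ) - t'| :=
    fun t t' => by
      have h1 := hM.utility_ge t t'
      have h2 := (le_abs_self _).trans (hL (M.alloc t) t' t'.2 t t.2)
      linarith
  refine (LipschitzWith.of_dist_le_mul (K := L.toNNReal) fun t t' => ?_).continuous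
  rw [Real.dist_eq, Subtype.dist_eq, Real.dist_eq]
  refine le_trans (b := L * |(t : ℝ) - t'|) (abs_le.2 ⟨?_, h1 t t'⟩)
    (mul_le_mul_of_nonneg_right (Real.le_coe_toNNReal L) (abs_nonneg _))
  have := h1 t' t
  rw [abs_sub_comm] at this
  linarith

variable [DecidableEq Ω] [Fact (a ≤ b)]

theorem IsFeasible.integrable_surplus (hu : IsIndirectUtility a b u)
    (hsymm : IsSymmetricEnv a b u) {M : Mechanism Ω a b} (hM : M.IsFeasible u)
    (ν : Measure (Icc a b)) [IsProbabilityMeasure ν] :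
    Integrable (fun t : Icc a b => value u (M.alloc t) t) ν := by
  -- The surplus is the sum of the utility, measurable because monotone, and the payment.
  have hm : Measurable fun t : Icc a b => value u (M.alloc t) t := by
    have := (hM.utility_monotone hu).measurable.add M.measurable_pay
    convert this using 1
    ext t
    simp [utility]
  refine Integrable.of_bound hm.aestronglyMeasurable
    (value u (fullInformation Ω) (⊤ : Icc a b)) (Filter.Eventually.of_forall fun t => ?_)
  rw [Real.norm_of_nonneg (value_nonneg hu hsymm _ t.2)]
  exact (value_le_fullInformation hu hsymm _ t.2).trans
    (value_mono hu _ t.2 (⊤ : Icc a b).2 (le_top : t ≤ ⊤))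

theorem IsFeasible.objective_eq (hu : IsIndirectUtility a b u)
    (hsymm : IsSymmetricEnv a b u) {f w : Icc a b → ℝ} (hf : IsTypeDensity a b f)
    (hw : Antitone w) {M : Mechanism Ω a b} (hM : M.IsFeasible u) :
    M.objective u f w =
      ∫ t, (value u (M.alloc t) t + (w t - 1) * M.utility u t) ∂typeLaw f := by
  have := isProbabilityMeasure_typeLaw hf
  have hU := (hM.utility_monotone hu).integrable_of_boundedOrder (ν := typeLaw f)
  have hS := hM.integrable_surplus hu hsymm (typeLaw f)
  have hwU := integrable_antitone_sub_one_mul hw hU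
  have hpay : Integrable M.pay (typeLaw f) := (hS.sub hU).congr
    (Filter.Eventually.of_forall fun t => by simp [utility])
  rw [objective, expect_eq_integral hf, expect_eq_integral hf, ← integral_add _ hpay]
  · congr 1
    ext t
    simp only [utility]
    ring
  · refine (hwU.add hU).congr (Filter.Eventually.of_forall fun t => ?_)
    simp only [utility, Pi.add_apply]
    ring

end Mechanism

end Mechanisms

/-! ### Increasing concavity: posting a price for full information. -/

section Concave

variable {Ω : Type*} [Fintype Ω] [DecidableEq Ω] [Nonempty Ω] {a b : ℝ}
  {u : (Ω → ℝ) → ℝ → ℝ}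

/-- The utility at `μ` lies between those at the prior and at a vertex, and chord slopes of the
concave `g` decrease. Hence the share of the full-information gain obtained at `μ` rises with the
type. -/
theorem IncreasinglyConcave.gain_mul_le (hconc : IncreasinglyConcave a b u)
    (hu : IsIndirectUtility a b u) (hsymm : IsSymmetricEnv a b u) (μ : stdSimplex ℝ Ω) (ω : Ω)
    {s t : ℝ} (hs : s ∈ Icc a b) (ht : t ∈ Icc a b) (hst : s ≤ t) :
    (u μ.1 s - u (prior Ω).1 s) * (u (truthOrNoiseBelief 1 ω).1 t - u (prior Ω).1 t) ≤
      (u μ.1 t - u (prior Ω).1 t) *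
        (u (truthOrNoiseBelief 1 ω).1 s - u (prior Ω).1 s) := by
  rcases hst.eq_or_lt with rfl | hlt
  · exact le_of_eq (by ring)
  obtain ⟨g, hg, -, hgu⟩ := hconc s hs t ht hlt
  have h0 := prior_le hu hsymm μ hs
  have h1 := le_vertex hu hsymm μ ω hs
  rw [hgu μ.1 μ.2, hgu _ (prior Ω).2, hgu _ (truthOrNoiseBelief 1 ω).2]
  have m0 : u (prior Ω).1 s ∈ (fun μ => u μ s) '' stdSimplex ℝ Ω := ⟨_, (prior Ω).2, rfl⟩
  have m1 : u (truthOrNoiseBelief 1 ω).1 s ∈ (fun μ => u μ s) '' stdSimplex ℝ Ω :=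
    ⟨_, (truthOrNoiseBelief 1 ω).2, rfl⟩
  generalize u (prior Ω).1 s = x at *
  generalize u (truthOrNoiseBelief 1 ω).1 s = z at *
  generalize u μ.1 s = y at *
  rcases h0.eq_or_lt with rfl | hxy
  · simp
  rcases h1.eq_or_lt with rfl | hyz
  · exact le_of_eq (by ring)
  have := hg.slope_anti_adjacent m0 m1 hxy hyz
  rw [div_le_div_iff₀ (by linarith) (by linarith)] at this
  nlinarith

theorem IncreasinglyConcave.value_mul_le (hconc : IncreasinglyConcave a b u)
    (hu : IsIndirectUtility a b u) (hsymm : IsSymmetricEnv a b u) (γ : Experiment Ω)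
    {s t : ℝ} (hs : s ∈ Icc a b) (ht : t ∈ Icc a b) (hst : s ≤ t) :
    value u γ s * value u (fullInformation Ω) t ≤
      value u γ t * value u (fullInformation Ω) s := by
  have ω : Ω := Classical.arbitrary Ω
  rw [fullInformation, value_truthOrNoise hsymm 1 ω hs, value_truthOrNoise hsymm 1 ω ht,
    value_eq_integral hu γ hs, value_eq_integral hu γ ht, ← integral_mul_const,
    ← integral_mul_const]
  exact integral_mono ((integrable_gain hu γ hs).mul_const _)
    ((integrable_gain hu γ ht).mul_const _)
    fun μ => hconc.gain_mul_le hu hsymm μ ω hs ht hst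

/-- Fully informative experiments sold at the reservation value of the type `y`. -/
noncomputable def postedPrice (Ω : Type*) [Fintype Ω] [DecidableEq Ω] [Nonempty Ω]
    (u : (Ω → ℝ) → ℝ → ℝ) (y : Icc a b) : Mechanism Ω a b where
  alloc t := if y ≤ t then fullInformation Ω else noInformation Ω
  pay t := if y ≤ t then value u (fullInformation Ω) y else 0
  measurable_alloc := Measurable.ite measurableSet_Ici measurable_const measurable_const
  measurable_pay := Measurable.ite measurableSet_Ici measurable_const measurable_const

theorem utility_postedPrice (y t : Icc a b) :
    (postedPrice Ω u y).utility u t =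
      value u (fullInformation Ω) (max t y : Icc a b) - value u (fullInformation Ω) y := by
  simp only [Mechanism.utility, postedPrice]
  split_ifs with h
  · rw [max_eq_left h]
  · rw [max_eq_right (le_of_not_ge h), value_noInformation]
    simp

theorem isFeasible_postedPrice (hu : IsIndirectUtility a b u) (y : Icc a b) :
    (postedPrice Ω u y).IsFeasible u := by
  refine ⟨fun t t' => ?_, fun t => ?_⟩
  · refine le_trans ?_ (utility_postedPrice (u := u) y t).symm.le
    simp only [postedPrice]
    split_ifs with h
    · exact sub_le_sub_right (value_mono hu _ t.2 (max t y).2 (le_max_left t y)) _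
    · rw [value_noInformation, sub_zero]
      exact sub_nonneg.2 (value_mono hu _ y.2 (max t y).2 (le_max_right t y))
  · refine le_trans ?_ (utility_postedPrice (u := u) y t).symm.le
    exact sub_nonneg.2 (value_mono hu _ y.2 (max t y).2 (le_max_right t y))

theorem isOptimalMenu_fullInformation (hab : a ≤ b) {f w : Icc a b → ℝ}
    (hf : IsTypeDensity a b f) (hw : IsRedistributiveWeight f w)
    (hu : IsIndirectUtility a b u) (hsymm : IsSymmetricEnv a b u)
    (hconc : IncreasinglyConcave a b u) : IsOptimalMenu u f w {fullInformation Ω} := by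
  have : Fact (a ≤ b) := ⟨hab⟩
  have := isProbabilityMeasure_typeLaw hf
  have := nullSingletonClass_typeLaw (f := f)
  have hw1 : ∫ t, w t ∂typeLaw f ≤ 1 := expect_eq_integral hf w ▸ hw.expect_le_one
  let H : Icc a b → ℝ := fun t => value u (fullInformation Ω) t
  have hHm : Monotone H := fun t t' ht => value_mono hu _ t.2 t'.2 ht
  have hH0 : ∀ t, 0 ≤ H t := fun t => value_nonneg hu hsymm _ t.2
  have hHc : Continuous H := by
    obtain ⟨L, hL⟩ := exists_value_lipschitz hu
    refine (LipschitzWith.of_dist_le_mul (K := L.toNNReal) fun t t' => ?_).continuous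
    rw [Real.dist_eq, Subtype.dist_eq, Real.dist_eq]
    exact (hL _ t' t'.2 t t.2).trans
      (mul_le_mul_of_nonneg_right (Real.le_coe_toNNReal L) (abs_nonneg _))
  obtain ⟨y, hy⟩ := IsScreening.exists_optimal_threshold (ν := typeLaw f) hHm hH0 hHc
    hw.antitone hw.nonneg hw1
  have hfeas := isFeasible_postedPrice (Ω := Ω) hu y
  refine ⟨postedPrice Ω u y, ⟨hfeas, fun M hM => ?_⟩, fun t => ?_⟩
  · rw [hM.objective_eq hu hsymm hf hw.antitone, hfeas.objective_eq hu hsymm hf hw.antitone]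
    have hobj : ∫ t, (value u ((postedPrice Ω u y).alloc t) t +
        (w t - 1) * (postedPrice Ω u y).utility u t) ∂typeLaw f =
        thresholdValue (typeLaw f) w H y := by
      unfold thresholdValue
      congr 1
      ext t
      rw [utility_postedPrice]
      congr 1
      simp only [postedPrice]
      split_ifs
      · rfl
      · exact value_noInformation _
    rw [hobj]
    refine hy _ _ (hM.continuous_utility hu) (hM.utility_monotone hu) (hM.ir _)
      (hM.integrable_surplus hu hsymm _) fun t => ?_
    have hv0 := value_nonneg hu hsymm (M.alloc t) t.2
    have hv1 : value u (M.alloc t) t ≤ H t := value_le_fullInformation hu hsymm _ t.2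
    -- The substitute is full information with probability `value / H`. If `H t = 0` the value
    -- vanishes as well, and probability `0` works.
    rcases (hH0 t).eq_or_lt with h0 | h0
    · refine ⟨0, ?_, fun t' ht' => ?_⟩
      · simp only [Icc.coe_zero, zero_mul]
        linarith
      · simpa using hM.utility_monotone hu ht'
    · refine ⟨⟨value u (M.alloc t) t / H t, div_nonneg hv0 h0.le, (div_le_one h0).2 hv1⟩,
        ?_, fun t' ht' => ?_⟩
      · simp only
        rw [div_mul_cancel₀ _ h0.ne']
      · have h1 := hM.utility_ge t t'
        have h2 : value u (M.alloc t) t / H t * H t' ≤ value u (M.alloc t) t' := by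
          rw [div_mul_eq_mul_div, div_le_iff₀ h0]
          exact hconc.value_mul_le hu hsymm _ t.2 t'.2 ht'
        simp only
        rw [div_mul_cancel₀ _ h0.ne']
        linarith
  · simp only [postedPrice]
    split_ifs <;> simp

end Concave

/-! ### Increasing convexity: truth-or-noise experiments. -/

section Convex

variable {Ω : Type*} [Fintype Ω] [DecidableEq Ω] [Nonempty Ω] {a b : ℝ}
  {u : (Ω → ℝ) → ℝ → ℝ}

theorem _root_.ConvexOn.sub_mul_sub_le {s : Set ℝ} {g : ℝ → ℝ} (hg : ConvexOn ℝ s g)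
    {x y z : ℝ} (hx : x ∈ s) (hz : z ∈ s) (hxy : x ≤ y) (hyz : y ≤ z) :
    (g y - g x) * (z - y) ≤ (y - x) * (g z - g y) := by
  rcases hxy.eq_or_lt with rfl | hxy
  · simp
  rcases hyz.eq_or_lt with rfl | hyz
  · simp
  have := hg.slope_mono_adjacent hx hz hxy hyz
  rw [div_le_div_iff₀ (by linarith) (by linarith)] at this
  linarith

/-- The gain of the type `t` from the truth-or-noise experiment `γ_α`. -/
noncomputable def noiseGain (u : (Ω → ℝ) → ℝ → ℝ) (α : unitInterval) (t : Icc a b) : ℝ :=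
  u (truthOrNoiseBelief α (Classical.arbitrary Ω)).1 t - u (prior Ω).1 t

theorem noiseGain_zero (t : Icc a b) : noiseGain u 0 t = 0 := by
  rw [noiseGain, truthOrNoiseBelief_zero, sub_self]

theorem noiseGain_nonneg (hu : IsIndirectUtility a b u) (hsymm : IsSymmetricEnv a b u)
    (α : unitInterval) (t : Icc a b) : 0 ≤ noiseGain u α t :=
  sub_nonneg.2 (prior_le hu hsymm _ t.2)

/-- The gain is convex along the truth-or-noise beliefs. -/
theorem noiseGain_convex (hu : IsIndirectUtility a b u) (t : Icc a b)
    {α β γ : unitInterval} {p q : ℝ} (hp : 0 ≤ p) (hq : 0 ≤ q) (hpq : p + q = 1)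
    (hβ : (β : ℝ) = p * α + q * γ) :
    noiseGain u β t ≤ p * noiseGain u α t + q * noiseGain u γ t := by
  set ω := Classical.arbitrary Ω
  have h := (hu.convexOn t t.2).2 (truthOrNoiseBelief α ω).2 (truthOrNoiseBelief γ ω).2
    hp hq hpq
  have e : p • (truthOrNoiseBelief α ω).1 + q • (truthOrNoiseBelief γ ω).1 =
      (truthOrNoiseBelief β ω).1 := by
    ext x
    simp only [truthOrNoiseBelief, Pi.add_apply, Pi.smul_apply, smul_eq_mul, hβ]
    have : p = 1 - q := by linarith
    subst this
    ring
  rw [e] at h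
  simp only [smul_eq_mul] at h
  simp only [noiseGain]
  have : p = 1 - q := by linarith
  subst this
  linarith

theorem noiseGain_mono (hu : IsIndirectUtility a b u) (hsymm : IsSymmetricEnv a b u)
    (t : Icc a b) : Monotone fun α => noiseGain u α t := by
  intro α β hαβ
  have hαβ' : (α : ℝ) ≤ β := hαβ
  rcases (show (0 : ℝ) ≤ β from β.2.1).eq_or_lt with h0 | h0
  · have : α = β := Subtype.ext (le_antisymm hαβ' (h0 ▸ α.2.1))
    rw [this]
  have h1 : (α : ℝ) / β ≤ 1 := (div_le_one h0).2 hαβ'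
  have h2 := noiseGain_convex hu t (α := 0) (β := α) (γ := β) (sub_nonneg.2 h1)
    (div_nonneg α.2.1 h0.le) (by ring) (by
      rw [div_mul_cancel₀ _ h0.ne']; simp)
  rw [noiseGain_zero, mul_zero, zero_add] at h2
  exact h2.trans (mul_le_of_le_one_left (noiseGain_nonneg hu hsymm β t) h1)

theorem isScreening_noiseGain (hu : IsIndirectUtility a b u) (hsymm : IsSymmetricEnv a b u)
    (hconv : StrictlyIncreasinglyConvex a b u) :
    IsScreening (noiseGain (a := a) (b := b) u) := by
  set ω := Classical.arbitrary Ω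
  have hmem : ∀ (α : unitInterval) (s : ℝ),
      u (truthOrNoiseBelief α ω).1 s ∈ (fun μ => u μ s) '' stdSimplex ℝ Ω :=
    fun α s => ⟨_, (truthOrNoiseBelief α ω).2, rfl⟩
  have hcross : ∀ α β γ : unitInterval, α ≤ β → β ≤ γ → ∀ t t' : Icc a b, t ≤ t' →
      (noiseGain u β t' - noiseGain u α t') * (noiseGain u γ t - noiseGain u β t) ≤
      (noiseGain u β t - noiseGain u α t) * (noiseGain u γ t' - noiseGain u β t') := by
    intro α β γ hαβ hβγ t t' ht
    rcases ht.eq_or_lt with rfl | hlt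
    · exact le_rfl
    obtain ⟨g, hg, -, hgu⟩ := hconv t t.2 t' t'.2 hlt
    have h1 := noiseGain_mono hu hsymm t hαβ
    have h2 := noiseGain_mono hu hsymm t hβγ
    simp only [noiseGain, sub_le_sub_iff_right] at h1 h2
    have h3 := hg.convexOn.sub_mul_sub_le (hmem α t) (hmem γ t) h1 h2
    simp only [noiseGain, sub_sub_sub_cancel_right]
    rwa [← hgu _ (truthOrNoiseBelief _ ω).2, ← hgu _ (truthOrNoiseBelief _ ω).2,
      ← hgu _ (truthOrNoiseBelief _ ω).2] at h3
  have hright : ∀ α, Monotone (noiseGain (a := a) (b := b) u α) := fun α t t' ht =>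
    gain_mono hu _ t.2 t'.2 ht
  refine ⟨noiseGain_zero, noiseGain_mono hu hsymm, fun t => ?_, fun α => ?_,
    fun α β hαβ t t' ht => ?_, fun t α β γ _ hγ => ?_, hcross⟩
  · exact ((continuous_utility hu t.2).comp (continuous_truthOrNoiseBelief ω)).sub
      continuous_const
  · obtain ⟨L, hL⟩ := exists_gain_lipschitz hu
    refine (LipschitzWith.of_dist_le_mul (K := L.toNNReal) fun t t' => ?_).continuous
    rw [Real.dist_eq, Subtype.dist_eq, Real.dist_eq]
    exact (hL _ t' t'.2 t t.2).trans
      (mul_le_mul_of_nonneg_right (Real.le_coe_toNNReal L) (abs_nonneg _))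
  -- Log-supermodularity started at `0` makes the ratio of the gains at `β` and `α` nondecreasing in
  -- the type, which gives supermodularity when the gain at `α` is positive.
  · have h1 := hcross 0 α β bot_le hαβ t t' ht
    simp only [noiseGain_zero, sub_zero] at h1
    have h2 := hright α ht
    have h3 := noiseGain_mono hu hsymm t hαβ
    have h4 := hright β ht
    simp only at h3 ⊢
    rcases (noiseGain_nonneg hu hsymm α t).eq_or_lt with h5 | h5
    · rw [← h5, zero_mul] at h1
      rcases (noiseGain_nonneg hu hsymm β t).eq_or_lt with h6 | h6
      · have := noiseGain_mono hu hsymm t' hαβ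
        simp only at this
        linarith
      · have : noiseGain u α t' ≤ 0 := by
          by_contra hc
          push Not at hc
          nlinarith
        linarith
    · by_contra hc
      push Not at hc
      nlinarith
  · have h := noiseGain_convex hu t (α := α) (β := β) (γ := γ) (p := 1 / 2) (q := 1 / 2)
      (by norm_num) (by norm_num) (by norm_num) (by linarith)
    linarith

/-- `β` is the certainty equivalent of `γ` for type `t`, found by the intermediate value theorem
between the prior and a vertex. A higher type's utility is a convex `g` of that of `t`, so by
Jensen's inequality it values the spread of `γ` at least as much. -/
theorem StrictlyIncreasinglyConvex.exists_noise_le (hu : IsIndirectUtility a b u)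
    (hsymm : IsSymmetricEnv a b u) (hconv : StrictlyIncreasinglyConvex a b u)
    (γ : Experiment Ω) (t : Icc a b) :
    ∃ β, value u γ t = noiseGain u β t ∧
      ∀ t' : Icc a b, t ≤ t' → noiseGain u β t' ≤ value u γ t' := by
  set ω := Classical.arbitrary Ω
  have hc := continuous_utility hu t.2
  obtain ⟨β, hβ⟩ : ∃ β, u (truthOrNoiseBelief β ω).1 t =
      ∫ μ : stdSimplex ℝ Ω, u μ.1 t ∂γ.law := by
    refine mem_range_of_exists_le_of_exists_ge
      (hc.comp (continuous_truthOrNoiseBelief ω)) ⟨0, ?_⟩ ⟨1, ?_⟩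
    · have := value_nonneg hu hsymm γ t.2
      simp only [value, truthOrNoiseBelief_zero] at this ⊢
      linarith
    · have := value_le_fullInformation hu hsymm γ t.2
      rw [fullInformation, value_truthOrNoise hsymm 1 ω t.2, value] at this
      linarith
  refine ⟨β, by rw [value, noiseGain, hβ], fun t' ht' => ?_⟩
  rcases ht'.eq_or_lt with rfl | hlt
  · rw [value, noiseGain, hβ]
  obtain ⟨g, hg, -, hgu⟩ := hconv t t.2 t' t'.2 hlt
  have himage : (fun μ => u μ t) '' stdSimplex ℝ Ω = range fun μ : stdSimplex ℝ Ω => u μ.1 t := by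
    ext x
    simp
  -- Convexity alone does not give continuity at the ends of the range. It follows because `g`
  -- composed with the quotient map `u · t` is the continuous `u · t'`.
  have hgc : ContinuousOn g ((fun μ => u μ t) '' stdSimplex ℝ Ω) := by
    rw [himage, continuousOn_iff_continuous_domRestrict]
    have hq : Topology.IsQuotientMap (rangeFactorization fun μ : stdSimplex ℝ Ω => u μ.1 t) :=
      (hc.subtype_mk _).isClosedMap.isQuotientMap (hc.subtype_mk _) rangeFactorization_surjective
    rw [hq.continuous_iff]
    refine (continuous_utility hu t'.2).congr fun μ => ?_
    exact hgu μ.1 μ.2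
  have hcl : IsClosed ((fun μ => u μ t) '' stdSimplex ℝ Ω) := by
    rw [himage]
    exact (isCompact_range hc).isClosed
  have hint : Integrable (g ∘ fun μ : stdSimplex ℝ Ω => u μ.1 t) γ.law :=
    (integrable_utility hu γ t'.2).congr (Filter.Eventually.of_forall fun μ => hgu μ.1 μ.2)
  have h := hg.convexOn.map_integral_le hgc hcl
    (Filter.Eventually.of_forall fun μ : stdSimplex ℝ Ω => ⟨μ.1, μ.2, rfl⟩)
    (integrable_utility hu γ t.2) hint
  rw [← hβ, ← hgu _ (truthOrNoiseBelief β ω).2] at h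
  simp only [← hgu _ (Subtype.prop _)] at h
  rw [noiseGain, value]
  linarith

theorem isOptimalMenu_truthOrNoise (hab : a ≤ b) {f w : Icc a b → ℝ}
    (hf : IsTypeDensity a b f) (hw : IsRedistributiveWeight f w)
    (hu : IsIndirectUtility a b u) (hsymm : IsSymmetricEnv a b u)
    (hconv : StrictlyIncreasinglyConvex a b u) :
    IsOptimalMenu u f w (range (truthOrNoise Ω)) := by
  have : Fact (a ≤ b) := ⟨hab⟩
  have := isProbabilityMeasure_typeLaw hf
  have := nullSingletonClass_typeLaw (f := f)
  have hw1 : ∫ t, w t ∂typeLaw f ≤ 1 := expect_eq_integral hf w ▸ hw.expect_le_one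
  have hh := isScreening_noiseGain hu hsymm hconv
  obtain ⟨p, hp, hopt⟩ := hh.exists_optimal (ν := typeLaw f) hw.antitone hw.nonneg hw1
  have hval : ∀ t s : Icc a b, value u (truthOrNoise Ω (p.1 t)) s = noiseGain u (p.1 t) s :=
    fun t s => value_truthOrNoise hsymm _ _ s.2
  let N : Mechanism Ω a b :=
    { alloc := fun t => truthOrNoise Ω (p.1 t)
      pay := fun t => noiseGain u (p.1 t) t - p.2 t
      measurable_alloc := measurable_truthOrNoise.comp hp.1.measurable
      measurable_pay := (hh.surplus_monotone hp.1).measurable.sub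
        (hh.utility_monotone hp).measurable }
  have hNU : ∀ t, N.utility u t = p.2 t := fun t => by
    simp only [Mechanism.utility, N, hval]
    ring
  have hN : N.IsFeasible u := by
    refine ⟨fun t t' => ?_, fun t => ?_⟩
    · have := hp.2.2 t' t
      simp only [N, hval]
      linarith
    · exact (hp.2.1 t).1.trans (hNU t).symm.le
  refine ⟨N, ⟨hN, fun M hM => ?_⟩, fun t => mem_insert_of_mem _ ⟨_, rfl⟩⟩
  rw [hM.objective_eq hu hsymm hf hw.antitone, hN.objective_eq hu hsymm hf hw.antitone]
  simp only [hNU]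
  simp only [N, hval]
  refine hopt _ _ (hM.continuous_utility hu) (hM.utility_monotone hu) (hM.ir _)
    (hM.integrable_surplus hu hsymm _) fun t => ?_
  obtain ⟨β, hβ, hβ'⟩ := hconv.exists_noise_le hu hsymm (M.alloc t) t
  refine ⟨β, hβ, fun t' ht' => ?_⟩
  have h1 := hM.utility_ge t t'
  have h2 := hβ' t' ht'
  linarith

end Convex

end SellingInformation

theorem mainTheorem10 {Ω : Type*} [Fintype Ω] [DecidableEq Ω] [Nonempty Ω]
    (a b : ℝ) (hab : a < b)
    (f w : Set.Icc a b → ℝ)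
    (hf : SellingInformation.IsTypeDensity a b f)
    (hw : SellingInformation.IsRedistributiveWeight f w)
    (u : (Ω → ℝ) → ℝ → ℝ)
    (hu : SellingInformation.IsIndirectUtility a b u)
    (hsymm : SellingInformation.IsSymmetricEnv a b u) :
    (SellingInformation.IncreasinglyConcave a b u →
      SellingInformation.IsOptimalMenu u f w {SellingInformation.fullInformation Ω}) ∧
    (SellingInformation.StrictlyIncreasinglyConvex a b u →
      SellingInformation.IsOptimalMenu u f w
        (Set.range (SellingInformation.truthOrNoise Ω))) :=
  ⟨SellingInformation.isOptimalMenu_fullInformation hab.le hf hw hu hsymm,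
    SellingInformation.isOptimalMenu_truthOrNoise hab.le hf hw hu hsymm⟩
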